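/- Let $C$ be a finite abstract simplicial complex of dimension $2$ (not necessarily pure). Suppose that $C$ is contractible, i.e. its underlying topological space (geometric realization) is contractible, and that $C$ is non-collapsible. Then $C$ has at least $8$ vertices and at least $17$ triangles. Here a face of $C$ is called free if it is contained in exactly one face of $C$ of the next higher dimension; an elementary collapse removes a free face together with that unique larger face; and $C$ is collapsible if some finite (possibly empty) sequence of elementary collapses reduces $C$ to a single vertex, and non-collapsible otherwise. -/

import Mathlib

namespace PreAbstractSimplicialComplex

variable {V : Type*}

/-- The vertices of `K` (elements of `V` that span no face are not vertices). -/
def vertexSet (K : PreAbstractSimplicialComplex V) : Set V :=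
  {v | {v} ∈ K.faces}

/-- The triangles of `K`, i.e. its faces with three vertices. -/
def triangles (K : PreAbstractSimplicialComplex V) : Set (Finset V) :=
  {s | s ∈ K.faces ∧ s.card = 3}

/-- `K` is a `2`-complex: it has dimension exactly two (not necessarily pure). -/
def IsTwoDimensional (K : PreAbstractSimplicialComplex V) : Prop :=
  (∀ s ∈ K.faces, s.card ≤ 3) ∧ ∃ s ∈ K.faces, s.card = 3

/-- The underlying topological space of a finite complex `K`, in barycentric coordinates and with
the topology induced from `V → ℝ`: convex combinations of the vertices of a face of `K`. -/
def realization (K : PreAbstractSimplicialComplex V) : Set (V → ℝ) :=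
  {x | (∀ v, 0 ≤ x v) ∧ ∃ s ∈ K.faces, (∀ v, v ∉ s → x v = 0) ∧ ∑ v ∈ s, x v = 1}

/-- `K` is contractible: its underlying topological space is contractible. -/
def IsContractible (K : PreAbstractSimplicialComplex V) : Prop :=
  ContractibleSpace K.realization

/-- `t` is a face of `K` covering `s` in the face poset: there is an arc from `s` to `t` in the
Hasse diagram of `K`. -/
def IsCoface (K : PreAbstractSimplicialComplex V) (s t : Finset V) : Prop :=
  t ∈ K.faces ∧ s ⊆ t ∧ t.card = s.card + 1

/-- `s` is a free face of `K` and `t` is the unique face of `K` of the next dimension that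
contains it. -/
def IsFreeFace (K : PreAbstractSimplicialComplex V) (s t : Finset V) : Prop :=
  s ∈ K.faces ∧ K.IsCoface s t ∧ ∀ u, K.IsCoface s u → u = t

/-- `L` arises from `K` by an elementary collapse: a free face is removed, together with the
unique face that properly contains it. -/
def ElementaryCollapse (K L : PreAbstractSimplicialComplex V) : Prop :=
  ∃ s t, K.IsFreeFace s t ∧ L.faces = K.faces \ {s, t}

/-- `K` is collapsible: a finite (possibly empty) sequence of elementary collapses leads from `K`
to a single vertex. The customary last step, from a vertex to the empty complex, is omitted. -/
def IsCollapsible (K : PreAbstractSimplicialComplex V) : Prop :=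
  ∃ (L : PreAbstractSimplicialComplex V) (v : V),
    Relation.ReflTransGen ElementaryCollapse K L ∧ L.faces = {{v}}

end PreAbstractSimplicialComplex

/-! Connectedness and the triviality of integral 1-cocycles both follow from contractibility and
survive the collapses used. If every nonempty family of triangles had a free edge, one could
collapse all triangles away; the remaining graph would be connected with trivial cocycles, hence a
tree, and would collapse to a vertex. So a non-collapsible C contains a nonempty family T without
free edges (`isCollapsible_of_no_core`).

Contractibility also rules out nonzero 2-cycles mod 2 (`eq_empty_of_isCycle`). Instead of homology,
the proof uses that a continuous field of nonzero idempotents on a compact contractible space has a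
nonvanishing section. Applied to a line field twisted once over a triangle τ of a cycle, this yields
a function that is zero-free off the interior of τ and whose square roots on the edges have a sign
mismatch around τ but around no other triangle. Multiplied over the cycle these signs give both -1
and 1.

The rest is counting (`bounds`). Pass to a minimal T, with n vertices, m edges, f triangles and d
edges of odd degree. Since the boundary maps compose to zero, ∂₂ is injective on chains of T and T
is connected, f + n ≤ m + 1. Since all degrees are at least 2, 2m + d ≤ 3f. The odd edges form the
boundary of T, a nonempty graph with even degrees, so d ≥ 3. Together these give f ≥ 2n - 2 + d ≥ 2n
+ 1 and n(n-1)/2 ≥ m ≥ 3n - 3 + d ≥ 3n, so n ≥ 7; a separate argument excludes n = 7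
(`not_card_verts_eq_seven`). -/

/-! ### Counting in families of triangles without free edges -/

section Counting

open Finset

namespace TriangleFamily

variable {V : Type*} [DecidableEq V]

/-- The number of members of `T` that contain `e`. -/
def deg (T : Finset (Finset V)) (e : Finset V) : ℕ := #{t ∈ T | e ⊆ t}

/-- The pairs contained in a member of `T`. -/
def edges (T : Finset (Finset V)) : Finset (Finset V) := T.biUnion (powersetCard 2)

/-- The points contained in a member of `T`. -/
def verts (T : Finset (Finset V)) : Finset V := T.biUnion id

/-- Every pair in a member of `T` is contained in at least two members of `T`. -/
def NoFreeEdge (T : Finset (Finset V)) : Prop := ∀ t ∈ T, ∀ e ⊆ t, #e = 2 → 2 ≤ deg T e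

/-- `T` is a cycle with coefficients in `ℤ/2`. -/
def IsCycle (T : Finset (Finset V)) : Prop := ∀ e, #e = 2 → Even (deg T e)

lemma mem_edges {T : Finset (Finset V)} {e : Finset V} :
    e ∈ edges T ↔ #e = 2 ∧ ∃ t ∈ T, e ⊆ t := by
  simp only [edges, mem_biUnion, mem_powersetCard]; tauto

lemma mem_verts {T : Finset (Finset V)} {v : V} : v ∈ verts T ↔ ∃ t ∈ T, v ∈ t := by
  simp [verts]

lemma powersetCard_two_triple {a b c : V} (hab : a ≠ b) (hac : a ≠ c) (hbc : b ≠ c) :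
    powersetCard 2 {a, b, c} = ({{a, b}, {a, c}, {b, c}} : Finset (Finset V)) := by
  have h3 : #({a, b, c} : Finset V) = 3 := card_eq_three.2 ⟨a, b, c, hab, hac, hbc, rfl⟩
  symm
  apply eq_of_subset_of_card_le
  · intro e he
    simp only [mem_insert, mem_singleton] at he
    rw [mem_powersetCard]
    rcases he with rfl | rfl | rfl
    · exact ⟨by intro x; simp; tauto, card_pair hab⟩
    · exact ⟨by intro x; simp; tauto, card_pair hac⟩
    · exact ⟨by intro x; simp; tauto, card_pair hbc⟩
  · rw [card_powersetCard, h3]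
    have : #({{a, b}, {a, c}, {b, c}} : Finset (Finset V)) = 3 := by
      apply card_eq_three.2 ⟨_, _, _, ?_, ?_, ?_, rfl⟩
      · intro h; have := h ▸ mem_insert_of_mem (a := b) (b := a) (mem_singleton_self b)
        simp at this; tauto
      · intro h; have := h ▸ mem_insert_self a {b}
        simp at this; tauto
      · intro h; have := h ▸ mem_insert_self a {c}
        simp at this; tauto
    rw [this]; decide

lemma card_pairs_at {t : Finset V} (ht : #t = 3) {v : V} (hv : v ∈ t) :
    #{e ∈ powersetCard 2 t | v ∈ e} = 2 := by
  obtain ⟨x, y, hxy, hxy'⟩ := card_eq_two.1 (show #(t.erase v) = 2 by rw [card_erase_of_mem hv, ht])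
  have h : ∀ w ∈ ({x, y} : Finset V), w ≠ v ∧ w ∈ t := fun w hw => mem_erase.1 (hxy' ▸ hw)
  obtain ⟨hxv, hxt⟩ := h x (by simp)
  obtain ⟨hyv, hyt⟩ := h y (by simp)
  have ht' : t = {v, x, y} := by rw [← insert_erase hv, hxy']
  rw [ht', powersetCard_two_triple hxv.symm hyv.symm hxy]
  rw [card_eq_two]
  refine ⟨{v, x}, {v, y}, ?_, ?_⟩
  · intro h; have := h ▸ mem_insert_of_mem (a := x) (b := v) (mem_singleton_self x)
    simp at this; tauto
  · ext e
    simp only [mem_filter, mem_insert, mem_singleton]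
    constructor
    · rintro ⟨rfl | rfl | rfl, h⟩
      · simp
      · simp
      · simp at h; grind
    · rintro (rfl | rfl) <;> simp

section
variable {T : Finset (Finset V)}

lemma sum_deg (h3 : ∀ t ∈ T, #t = 3) : ∑ e ∈ edges T, deg T e = 3 * #T := by
  simp only [deg, card_filter]
  rw [sum_comm]
  have : ∀ t ∈ T, (∑ e ∈ edges T, if e ⊆ t then 1 else 0) = 3 := by
    intro t ht
    rw [← card_filter]
    have : {e ∈ edges T | e ⊆ t} = powersetCard 2 t := by
      ext e; simp only [mem_filter, mem_edges, mem_powersetCard]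
      constructor
      · tauto
      · rintro ⟨h1, h2⟩; exact ⟨⟨h2, t, ht, h1⟩, h1⟩
    rw [this, card_powersetCard, h3 t ht]; decide
  rw [sum_congr rfl this]; simp [mul_comm]

lemma pairs_at_filter {t : Finset V} (ht : t ∈ T) (v : V) :
    {e ∈ edges T | v ∈ e ∧ e ⊆ t} = {e ∈ powersetCard 2 t | v ∈ e} := by
  ext e; simp only [mem_filter, mem_edges, mem_powersetCard]
  constructor
  · tauto
  · rintro ⟨⟨h1, h2⟩, h3⟩; exact ⟨⟨h2, t, ht, h1⟩, h3, h1⟩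

lemma even_card_pairs_at (h3 : ∀ t ∈ T, #t = 3) {t : Finset V} (ht : t ∈ T) (v : V) :
    Even #{e ∈ edges T | v ∈ e ∧ e ⊆ t} := by
  rw [pairs_at_filter ht]
  by_cases hv : v ∈ t
  · rw [card_pairs_at (h3 t ht) hv]; decide
  · rw [filter_eq_empty_iff.2]
    · simp
    · intro e he hve; exact hv ((mem_powersetCard.1 he).1 hve)

/-- The edges of odd degree. -/
def oddEdges (T : Finset (Finset V)) : Finset (Finset V) := {e ∈ edges T | Odd (deg T e)}

/-- A boundary mod 2 is a 1-cycle: summing the degrees of the edges at `v` counts each triangle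
through `v` exactly twice. -/
lemma even_oddEdges_at (h3 : ∀ t ∈ T, #t = 3) (v : V) : Even #{e ∈ oddEdges T | v ∈ e} := by
  have h : Even (∑ e ∈ edges T with v ∈ e, deg T e) := by
    simp only [deg, card_filter]
    rw [sum_comm]
    refine Finset.even_sum _ fun t ht => ?_
    rw [← card_filter, filter_filter]
    exact even_card_pairs_at h3 ht v
  rw [Finset.even_sum_iff_even_card_odd] at h
  convert h using 2
  rw [oddEdges, filter_filter, filter_filter]
  simp only [and_comm]

/-- An edge ab of an even graph continues at both ends, by some ac and bd. If these three are all
the edges and c ≠ d, then c would have degree one. -/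
lemma card_three_le_of_even {D : Finset (Finset V)} (h2 : ∀ e ∈ D, #e = 2) (hne : D.Nonempty)
    (heven : ∀ v, Even #{e ∈ D | v ∈ e}) :
    3 ≤ #D ∧ (#D = 3 → ∃ a b c, a ≠ b ∧ a ≠ c ∧ b ≠ c ∧ D = {{a, b}, {a, c}, {b, c}}) := by
  have key : ∀ e ∈ D, ∀ v ∈ e, ∃ w, w ≠ v ∧ {v, w} ∈ D ∧ {v, w} ≠ e := by
    intro e he v hv
    have hmem : e ∈ {e ∈ D | v ∈ e} := mem_filter.2 ⟨he, hv⟩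
    have h1 : 1 < #{e ∈ D | v ∈ e} := by
      have := card_pos.2 ⟨e, hmem⟩
      obtain ⟨k, hk⟩ := heven v
      omega
    obtain ⟨f, hf, hfe⟩ := exists_mem_ne h1 e
    obtain ⟨hfD, hvf⟩ := mem_filter.1 hf
    obtain ⟨x, y, hxy, rfl⟩ := card_eq_two.1 (h2 f hfD)
    simp only [mem_insert, mem_singleton] at hvf
    rcases hvf with rfl | rfl
    · exact ⟨y, hxy.symm, hfD, hfe⟩
    · exact ⟨x, hxy, by rwa [pair_comm], by rwa [pair_comm]⟩
  obtain ⟨e, he⟩ := hne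
  obtain ⟨a, b, hab, rfl⟩ := card_eq_two.1 (h2 e he)
  obtain ⟨c, hca, hc, hcb⟩ := key _ he a (by simp)
  obtain ⟨d, hdb, hd, hda⟩ := key _ he b (by simp)
  have hcb' : c ≠ b := by rintro rfl; exact hcb rfl
  have hda' : d ≠ a := by rintro rfl; exact hda (pair_comm _ _)
  have hne3 : ({a, c} : Finset V) ≠ {b, d} := by
    intro h
    have := h ▸ mem_insert_self a {c}
    simp at this; tauto
  have hsub : ({{a, b}, {a, c}, {b, d}} : Finset (Finset V)) ⊆ D := by
    intro f; simp only [mem_insert, mem_singleton]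
    rintro (rfl | rfl | rfl) <;> assumption
  have hcard : #({{a, b}, {a, c}, {b, d}} : Finset (Finset V)) = 3 :=
    card_eq_three.2 ⟨_, _, _, hcb.symm, hda.symm, hne3, rfl⟩
  refine ⟨hcard ▸ card_le_card hsub, fun hD => ?_⟩
  have hDeq := eq_of_subset_of_card_le hsub (by rw [hcard, hD])
  by_cases hcd : d = c
  · subst hcd; exact ⟨a, b, d, hab, hca.symm, hcb'.symm, hDeq.symm⟩
  · exfalso
    have h := heven c
    rw [← hDeq] at h
    have : ({e ∈ ({{a, b}, {a, c}, {b, d}} : Finset (Finset V)) | c ∈ e}) = {{a, c}} := by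
      ext f; simp only [mem_filter, mem_insert, mem_singleton]
      constructor
      · rintro ⟨rfl | rfl | rfl, h⟩
        · simp at h; tauto
        · rfl
        · simp at h; grind
      · rintro rfl; simp
    rw [this] at h
    simp at h

end

variable {T : Finset (Finset V)}

lemma deg_filter {p : Finset V → Prop} [DecidablePred p] {e : Finset V}
    (h : ∀ t ∈ T, e ⊆ t → p t) : deg (T.filter p) e = deg T e := by
  unfold deg
  rw [filter_filter]
  congr 1
  apply filter_congr
  intro t ht
  exact ⟨fun h => h.2, fun he => ⟨h t ht he, he⟩⟩

lemma deg_sdiff {S : Finset (Finset V)} (hS : S ⊆ T) (e : Finset V) :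
    deg (T \ S) e + deg S e = deg T e := by
  unfold deg
  rw [← card_union_of_disjoint, ← filter_union, sdiff_union_of_subset hS]
  exact disjoint_filter_filter disjoint_sdiff_self_left

/-- In a minimal family without free edges, functions that are constant on triangles are
constant. -/
lemma eq_of_minimal (hcore : NoFreeEdge T)
    (hmin : ∀ S ⊆ T, S.Nonempty → NoFreeEdge S → S = T) {A : Type*} [DecidableEq A] (h : V → A)
    (hh : ∀ t ∈ T, ∀ v ∈ t, ∀ w ∈ t, h v = h w) : ∀ v ∈ verts T, ∀ w ∈ verts T, h v = h w := by
  intro v hv w hw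
  obtain ⟨t, ht, hvt⟩ := mem_verts.1 hv
  obtain ⟨t', ht', hwt'⟩ := mem_verts.1 hw
  have hS : ({s ∈ T | ∀ x ∈ s, h x = h v}) = T := by
    apply hmin _ (filter_subset _ _)
    · exact ⟨t, mem_filter.2 ⟨ht, fun x hx => hh t ht x hx v hvt⟩⟩
    · intro s hs e he hecard
      obtain ⟨hsT, hs⟩ := mem_filter.1 hs
      rw [deg_filter]
      · exact hcore s hsT e he hecard
      · intro s' hs' hes' x hx
        obtain ⟨y, hy⟩ : e.Nonempty := card_pos.1 (by omega)
        rw [← hs y (he hy)]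
        exact hh s' hs' x hx y (hes' hy)
  rw [← hS] at ht'
  exact ((mem_filter.1 ht').2 w hwt').symm

lemma sum_zmod_two_eq_card {ι : Type*} (s : Finset ι) (x : ι → ZMod 2) :
    ∑ i ∈ s, x i = (#{i ∈ s | x i = 1} : ℕ) := by
  rw [card_filter, Nat.cast_sum]
  refine sum_congr rfl fun i _ => ?_
  have : ∀ a : ZMod 2, a = ((if a = 1 then 1 else 0 : ℕ) : ZMod 2) := by decide
  exact this (x i)

/-! ### Rank inequality for the boundary maps over ℤ/2 -/

/-- Edge-triangle incidences. -/
def edgeTriangle (T : Finset (Finset V)) : Matrix (edges T) T (ZMod 2) :=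
  fun e t => if e.1 ⊆ t.1 then 1 else 0

/-- Vertex-edge incidences. -/
def vertEdge (T : Finset (Finset V)) : Matrix (verts T) (edges T) (ZMod 2) :=
  fun v e => if v.1 ∈ e.1 then 1 else 0

lemma vertEdge_mul_edgeTriangle (h3 : ∀ t ∈ T, #t = 3) : vertEdge T * edgeTriangle T = 0 := by
  ext v t
  have h : (vertEdge T * edgeTriangle T) v t =
      ((#{e ∈ edges T | v.1 ∈ e ∧ e ⊆ t.1} : ℕ) : ZMod 2) := by
    rw [Matrix.mul_apply, card_filter, Nat.cast_sum, ← sum_coe_sort (edges T)]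
    refine sum_congr rfl fun e _ => ?_
    simp only [vertEdge, edgeTriangle]
    split_ifs <;> simp_all
  rw [h, Matrix.zero_apply, ZMod.natCast_eq_zero_iff_even]
  exact even_card_pairs_at h3 t.2 v

/-- A vector in the kernel is the indicator of a subfamily that is a cycle, hence zero. -/
lemma rank_edgeTriangle (hcyc : ∀ S ⊆ T, IsCycle S → S = ∅) : (edgeTriangle T).rank = #T := by
  rw [Matrix.rank, LinearMap.finrank_range_of_inj, Module.finrank_fintype_fun_eq_card,
    Fintype.card_coe]
  rw [← LinearMap.ker_eq_bot, LinearMap.ker_eq_bot']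
  intro x hx
  let y : Finset V → ZMod 2 := fun t => if h : t ∈ T then x ⟨t, h⟩ else 0
  have hy : ∀ t : T, y t.1 = x t := fun t => by simp [y]
  have hS := hcyc {t ∈ T | y t = 1} (filter_subset _ _) (by
    intro e he
    by_cases heT : e ∈ edges T
    · have h := congrFun hx ⟨e, heT⟩
      rw [← ZMod.natCast_eq_zero_iff_even]
      rw [Matrix.mulVecLin_apply, Matrix.mulVec, dotProduct] at h
      simp only [edgeTriangle, Pi.zero_apply, ite_mul, one_mul, zero_mul] at h
      simp only [← hy] at h
      rw [sum_coe_sort T (fun t => if e ⊆ t then y t else 0), ← sum_filter,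
        sum_zmod_two_eq_card] at h
      rw [deg, filter_filter]
      rw [filter_filter] at h
      simpa only [and_comm] using h
    · have : deg {t ∈ T | y t = 1} e = 0 := by
        rw [deg, card_eq_zero, filter_eq_empty_iff]
        intro t ht het
        exact heT (mem_edges.2 ⟨he, t, (mem_filter.1 ht).1, het⟩)
      rw [this]; decide)
  ext t
  rw [filter_eq_empty_iff] at hS
  have h1 := hS t.2
  rw [hy] at h1
  have : ∀ a : ZMod 2, a ≠ 1 → a = 0 := by decide
  exact this _ h1

/-- The kernel of the transpose consists of functions that agree at the two ends of each edge; by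
`hconn` these are constant, so the kernel has dimension at most one. -/
lemma card_verts_le_rank
    (hconn : ∀ h : V → ZMod 2, (∀ t ∈ T, ∀ v ∈ t, ∀ w ∈ t, h v = h w) →
      ∀ v ∈ verts T, ∀ w ∈ verts T, h v = h w) :
    #(verts T) ≤ (vertEdge T).rank + 1 := by
  rw [← Matrix.rank_transpose, Matrix.rank]
  have hrn := LinearMap.finrank_range_add_finrank_ker (vertEdge T).transpose.mulVecLin
  rw [Module.finrank_fintype_fun_eq_card, Fintype.card_coe] at hrn
  have hker : Module.finrank (ZMod 2) (LinearMap.ker (vertEdge T).transpose.mulVecLin) ≤ 1 := by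
    have hle : LinearMap.ker (vertEdge T).transpose.mulVecLin ≤
        Submodule.span (ZMod 2) {(fun _ => 1 : verts T → ZMod 2)} := by
      intro x hx
      rw [LinearMap.mem_ker] at hx
      let y : V → ZMod 2 := fun v => if h : v ∈ verts T then x ⟨v, h⟩ else 0
      have hy : ∀ v : verts T, y v.1 = x v := fun v => by simp [y]
      have hpair : ∀ v w, v ≠ w → {v, w} ∈ edges T → y v = y w := by
        intro v w hvw he
        have h := congrFun hx ⟨_, he⟩
        rw [Matrix.mulVecLin_apply, Matrix.mulVec, dotProduct] at h
        simp only [vertEdge, Matrix.transpose_apply, Pi.zero_apply, ite_mul, one_mul,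
          zero_mul] at h
        simp only [← hy] at h
        rw [sum_coe_sort (verts T) (fun u => if u ∈ ({v, w} : Finset V) then y u else 0),
          ← sum_filter] at h
        have hf : {u ∈ verts T | u ∈ ({v, w} : Finset V)} = {v, w} := by
          ext u; simp only [mem_filter, and_iff_right_iff_imp]
          intro hu
          obtain ⟨-, t, ht, het⟩ := mem_edges.1 he
          exact mem_verts.2 ⟨t, ht, het hu⟩
        rw [hf, sum_pair hvw] at h
        have : ∀ a b : ZMod 2, a + b = 0 → a = b := by decide
        exact this _ _ h
      have hc := hconn y (by
        intro t ht v hv w hw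
        by_cases hvw : v = w
        · rw [hvw]
        · refine hpair v w hvw (mem_edges.2 ⟨card_pair hvw, t, ht, ?_⟩)
          intro u; simp only [mem_insert, mem_singleton]; rintro (rfl | rfl) <;> assumption)
      rw [Submodule.mem_span_singleton]
      by_cases hne : (verts T).Nonempty
      · obtain ⟨v, hv⟩ := hne
        refine ⟨y v, ?_⟩
        ext w
        rw [← hy, ← hc v hv w w.2]; simp
      · refine ⟨0, ?_⟩
        ext w; exact absurd ⟨_, w.2⟩ hne
    exact (Submodule.finrank_mono hle).trans ((finrank_span_le_card _).trans (by simp))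
  omega

lemma card_add_card_verts_le (h3 : ∀ t ∈ T, #t = 3) (hcyc : ∀ S ⊆ T, IsCycle S → S = ∅)
    (hconn : ∀ h : V → ZMod 2, (∀ t ∈ T, ∀ v ∈ t, ∀ w ∈ t, h v = h w) →
      ∀ v ∈ verts T, ∀ w ∈ verts T, h v = h w) :
    #T + #(verts T) ≤ #(edges T) + 1 := by
  have h := Matrix.rank_add_rank_le_card_of_mul_eq_zero (vertEdge_mul_edgeTriangle h3)
  rw [rank_edgeTriangle hcyc, Fintype.card_coe] at h
  have := card_verts_le_rank hconn
  omega

lemma card_edges_le : #(edges T) ≤ (#(verts T)).choose 2 := by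
  rw [← card_powersetCard]
  apply card_le_card
  intro e he
  obtain ⟨h2, t, ht, het⟩ := mem_edges.1 he
  exact mem_powersetCard.2 ⟨fun v hv => mem_verts.2 ⟨t, ht, het hv⟩, h2⟩

lemma two_mul_card_edges_add_card_oddEdges_le (h3 : ∀ t ∈ T, #t = 3) (hcore : NoFreeEdge T) :
    2 * #(edges T) + #(oddEdges T) ≤ 3 * #T := by
  rw [← sum_deg h3, oddEdges, card_filter, mul_comm, ← smul_eq_mul, ← sum_const, ← sum_add_distrib]
  refine sum_le_sum fun e he => ?_
  obtain ⟨h2, t, ht, het⟩ := mem_edges.1 he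
  have := hcore t ht e het h2
  split_ifs with hodd
  · obtain ⟨k, hk⟩ := hodd; omega
  · omega

lemma card_of_mem_oddEdges {e : Finset V} (he : e ∈ oddEdges T) : #e = 2 :=
  (mem_edges.1 (mem_filter.1 he).1).1

lemma oddEdges_nonempty (hne : T.Nonempty) (hcyc : ∀ S ⊆ T, IsCycle S → S = ∅) :
    (oddEdges T).Nonempty := by
  by_contra h
  rw [not_nonempty_iff_eq_empty, oddEdges, filter_eq_empty_iff] at h
  apply hne.ne_empty
  apply hcyc T subset_rfl
  intro e he
  by_cases heT : e ∈ edges T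
  · exact Nat.not_odd_iff_even.1 (h heT)
  · have : deg T e = 0 := by
      rw [deg, card_eq_zero, filter_eq_empty_iff]
      intro t ht het
      exact heT (mem_edges.2 ⟨he, t, ht, het⟩)
    rw [this]; decide

/-- Families with the same boundary mod 2 differ by a cycle. -/
lemma eq_of_odd_iff (hcyc : ∀ S ⊆ T, IsCycle S → S = ∅) {S : Finset (Finset V)} (hS : S ⊆ T)
    (h : ∀ e, #e = 2 → (Odd (deg S e) ↔ Odd (deg T e))) : S = T := by
  have h0 := hcyc (T \ S) sdiff_subset (by
    intro e he
    have h1 := h e he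
    rw [← deg_sdiff hS e, Nat.odd_add'] at h1
    tauto)
  exact hS.antisymm (sdiff_eq_empty_iff_subset.1 h0)

lemma ite_subset_triple {a b c : V} (hab : a ≠ b) (hac : a ≠ c) (hbc : b ≠ c) {e : Finset V}
    (he : #e = 2) : (if e ⊆ {a, b, c} then 1 else 0) =
      (if e = {a, b} then 1 else 0) + (if e = {a, c} then 1 else 0) +
        (if e = {b, c} then 1 else 0) := by
  have h : e ⊆ {a, b, c} ↔ e = {a, b} ∨ e = {a, c} ∨ e = {b, c} := by
    have : e ⊆ {a, b, c} ↔ e ∈ powersetCard 2 {a, b, c} := by simp [mem_powersetCard, he]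
    rw [this, powersetCard_two_triple hab hac hbc]; simp
  have h1 : ({a, b} : Finset V) ≠ {a, c} := by
    intro h; have := h ▸ mem_insert_of_mem (a := b) (b := a) (mem_singleton_self b)
    simp at this; tauto
  have h2 : ({a, b} : Finset V) ≠ {b, c} := by
    intro h; have := h ▸ mem_insert_self a {b}
    simp at this; tauto
  have h3 : ({a, c} : Finset V) ≠ {b, c} := by
    intro h; have := h ▸ mem_insert_self a {c}
    simp at this; tauto
  split_ifs <;> simp_all

/-- The cone from `p` over the boundary of abc has the same boundary mod 2 as abc, because each edge
through `p` lies in two of its triangles. -/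
lemma odd_deg_cone {a b c p : V} (hab : a ≠ b) (hac : a ≠ c) (hbc : b ≠ c) (hap : a ≠ p)
    (hbp : b ≠ p) (hcp : c ≠ p) {e : Finset V} (he : #e = 2) :
    Odd (deg {{a, b, p}, {a, c, p}, {b, c, p}} e) ↔ e ⊆ {a, b, c} := by
  have h1 : ({a, b, p} : Finset V) ∉ ({{a, c, p}, {b, c, p}} : Finset (Finset V)) := by
    simp only [mem_insert, mem_singleton, not_or]
    constructor
    · intro h; have : b ∈ ({a, c, p} : Finset V) := h ▸ by simp
      simp at this; tauto
    · intro h; have : a ∈ ({b, c, p} : Finset V) := h ▸ by simp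
      simp at this; tauto
  have h2 : ({a, c, p} : Finset V) ∉ ({{b, c, p}} : Finset (Finset V)) := by
    simp only [mem_singleton]
    intro h; have : a ∈ ({b, c, p} : Finset V) := h ▸ by simp
    simp at this; tauto
  have h : deg {{a, b, p}, {a, c, p}, {b, c, p}} e = (if e ⊆ {a, b, c} then 1 else 0) +
      2 * ((if e = {a, p} then 1 else 0) + (if e = {b, p} then 1 else 0) +
        (if e = {c, p} then 1 else 0)) := by
    rw [deg, card_filter, sum_insert h1, sum_insert h2, sum_singleton,
      ite_subset_triple hab hap hbp he, ite_subset_triple hac hap hcp he,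
      ite_subset_triple hbc hbp hcp he, ite_subset_triple hab hac hbc he]
    ring
  rw [h]
  generalize (if e = {a, p} then 1 else 0) + (if e = {b, p} then 1 else 0) +
        (if e = {c, p} then 1 else 0) = k
  by_cases habc : e ⊆ {a, b, c}
  · rw [if_pos habc]; exact iff_of_true ⟨k, by ring⟩ habc
  · rw [if_neg habc]; exact iff_of_false (Nat.not_odd_iff_even.2 ⟨k, by ring⟩) habc

/-- Edges are dominated by their apices. -/
lemma deg_le_card_apices (h3 : ∀ t ∈ T, #t = 3) {a b c : V} (hab : a ≠ b)
    (habc : {a, b, c} ∉ T) :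
    deg T {a, b} ≤ #{p ∈ verts T \ {a, b, c} | {a, b, p} ∈ T} := by
  have : {t ∈ T | {a, b} ⊆ t} ⊆
      ({p ∈ verts T \ {a, b, c} | {a, b, p} ∈ T}).image (fun p => {a, b, p}) := by
    intro t ht
    obtain ⟨htT, hat⟩ := mem_filter.1 ht
    have hc : #(t \ {a, b}) = 1 := by
      rw [card_sdiff_of_subset hat, h3 t htT, card_pair hab]
    obtain ⟨p, hp⟩ := card_eq_one.1 hc
    have hpt : p ∈ t \ {a, b} := hp ▸ mem_singleton_self p
    simp only [mem_sdiff, mem_insert, mem_singleton, not_or] at hpt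
    have ht' : {a, b, p} = t := by
      rw [← sdiff_union_of_subset hat, hp]; ext x; simp; tauto
    refine mem_image.2 ⟨p, mem_filter.2 ⟨mem_sdiff.2 ⟨mem_verts.2 ⟨t, htT, hpt.1⟩, ?_⟩, ?_⟩, ht'⟩
    · simp only [mem_insert, mem_singleton, not_or]
      refine ⟨hpt.2.1, hpt.2.2, ?_⟩
      rintro rfl
      exact habc (ht' ▸ htT)
    · rwa [ht']
  exact (card_le_card this).trans card_image_le

/-- Three subsets of size at least three in a set of size four have a common element. -/
lemma exists_mem_of_three_le {W A B C : Finset V} (hW : #W = 4) (hA : A ⊆ W) (hB : B ⊆ W)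
    (hC : C ⊆ W) (h1 : 3 ≤ #A) (h2 : 3 ≤ #B) (h3 : 3 ≤ #C) : ∃ p, p ∈ A ∧ p ∈ B ∧ p ∈ C := by
  have e1 := card_union_add_card_inter A B
  have e2 := card_union_add_card_inter (A ∩ B) C
  have e3 := card_le_card (union_subset hA hB)
  have e4 := card_le_card (union_subset (inter_subset_left.trans hA : A ∩ B ⊆ W) hC)
  obtain ⟨p, hp⟩ := card_pos.1 (show 0 < #(A ∩ B ∩ C) by omega)
  simp only [mem_inter] at hp
  exact ⟨p, hp.1.1, hp.1.2, hp.2⟩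

lemma mem_oddEdges {e : Finset V} (he : #e = 2) : e ∈ oddEdges T ↔ Odd (deg T e) := by
  rw [oddEdges, mem_filter, and_iff_right_iff_imp]
  intro h
  obtain ⟨t, ht⟩ := card_pos.1 h.pos
  exact mem_edges.2 ⟨he, t, mem_filter.1 ht⟩

/-- The odd edges are the sides of a triangle abc, each of degree at least 3. If abc is not in `T`,
the apices over each side lie among the four other vertices, so the three sides share an apex p.
Either abc alone or the cone from p then has the boundary of `T`, hence is all of `T`, which
contradicts the degrees. -/
lemma not_card_verts_eq_seven (h3 : ∀ t ∈ T, #t = 3) (hne : T.Nonempty) (hcore : NoFreeEdge T)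
    (hcyc : ∀ S ⊆ T, IsCycle S → S = ∅) (hD : #(oddEdges T) = 3) : #(verts T) ≠ 7 := by
  intro h7
  obtain ⟨a, b, c, hab, hac, hbc, hDeq⟩ := (card_three_le_of_even
    (fun e => card_of_mem_oddEdges) (oddEdges_nonempty hne hcyc)
    (even_oddEdges_at h3)).2 hD
  have hodd : ∀ e, #e = 2 → (e ⊆ {a, b, c} ↔ Odd (deg T e)) := by
    intro e he
    rw [← mem_oddEdges he, hDeq, ← powersetCard_two_triple hab hac hbc, mem_powersetCard]
    simp [he]
  have hdeg : ∀ e, e ∈ oddEdges T → 3 ≤ deg T e := by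
    intro e he
    obtain ⟨h1, h2⟩ := mem_filter.1 he
    obtain ⟨h4, t, ht, het⟩ := mem_edges.1 h1
    have := hcore t ht e het h4
    obtain ⟨k, hk⟩ := h2
    omega
  have dab := hdeg {a, b} (by rw [hDeq]; simp)
  have dac := hdeg {a, c} (by rw [hDeq]; simp)
  have dbc := hdeg {b, c} (by rw [hDeq]; simp)
  have habc : {a, b, c} ∉ T := by
    intro h
    have hS := eq_of_odd_iff hcyc (S := {{a, b, c}}) (by simpa using h) (by
      intro e he
      rw [← hodd e he, deg, filter_singleton]
      split_ifs with h <;> simp [h])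
    have : deg T {a, b} ≤ #T := card_le_card (filter_subset _ _)
    rw [← hS, card_singleton, hS] at this
    omega
  have hsub : {a, b, c} ⊆ verts T := by
    have hv : ∀ e ∈ oddEdges T, e ⊆ verts T := by
      intro e he v hv
      obtain ⟨-, t, ht, het⟩ := mem_edges.1 (mem_filter.1 he).1
      exact mem_verts.2 ⟨t, ht, het hv⟩
    have v1 := hv {a, b} (by rw [hDeq]; simp)
    have v2 := hv {a, c} (by rw [hDeq]; simp)
    intro x hx
    simp only [mem_insert, mem_singleton] at hx
    rcases hx with rfl | rfl | rfl
    · exact v1 (by simp)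
    · exact v1 (by simp)
    · exact v2 (by simp)
  have hW : #(verts T \ {a, b, c}) = 4 := by
    rw [card_sdiff_of_subset hsub, h7, card_eq_three.2 ⟨a, b, c, hab, hac, hbc, rfl⟩]
  have p1 : ({a, c, b} : Finset V) = {a, b, c} := by ext x; simp; tauto
  have p2 : ({b, c, a} : Finset V) = {a, b, c} := by ext x; simp; tauto
  have eab := deg_le_card_apices h3 hab habc
  have eac := deg_le_card_apices h3 (c := b) hac (by rwa [p1])
  have ebc := deg_le_card_apices h3 (c := a) hbc (by rwa [p2])
  rw [p1] at eac
  rw [p2] at ebc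
  obtain ⟨p, hp1, hp2, hp3⟩ := exists_mem_of_three_le hW (filter_subset _ _) (filter_subset _ _)
    (filter_subset _ _) (dab.trans eab) (dac.trans eac) (dbc.trans ebc)
  obtain ⟨hpW, t1⟩ := mem_filter.1 hp1
  obtain ⟨-, t2⟩ := mem_filter.1 hp2
  obtain ⟨-, t3⟩ := mem_filter.1 hp3
  simp only [mem_sdiff, mem_insert, mem_singleton, not_or] at hpW
  obtain ⟨-, hpa, hpb, hpc⟩ := hpW
  have hS := eq_of_odd_iff hcyc (S := {{a, b, p}, {a, c, p}, {b, c, p}}) (by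
      intro t; simp only [mem_insert, mem_singleton]; rintro (rfl | rfl | rfl) <;> assumption) (by
      intro e he
      rw [← hodd e he, odd_deg_cone hab hac hbc (Ne.symm hpa) (Ne.symm hpb) (Ne.symm hpc) he])
  have : deg T {a, b} = 1 := by
    rw [← hS, deg, card_eq_one]
    refine ⟨{a, b, p}, ?_⟩
    ext t
    simp only [mem_filter, mem_insert, mem_singleton]
    constructor
    · rintro ⟨rfl | rfl | rfl, h⟩
      · rfl
      · have := h (mem_insert_of_mem (mem_singleton_self b)); simp at this; tauto
      · have := h (mem_insert_self a _); simp at this; tauto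
    · rintro rfl
      refine ⟨Or.inl rfl, ?_⟩
      intro x; simp; tauto
  omega

/-- Minimality serves only to make the family connected, as the rank inequality requires. The vertex
count 7 passes the numerical inequalities only with exactly three odd edges. -/
lemma bounds_of_minimal (h3 : ∀ t ∈ T, #t = 3) (hne : T.Nonempty) (hcore : NoFreeEdge T)
    (hmin : ∀ S ⊆ T, S.Nonempty → NoFreeEdge S → S = T) (hcyc : ∀ S ⊆ T, IsCycle S → S = ∅) :
    8 ≤ #(verts T) ∧ 17 ≤ #T := by
  have h1 := card_add_card_verts_le h3 hcyc (fun h => eq_of_minimal hcore hmin h)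
  have h2 := two_mul_card_edges_add_card_oddEdges_le h3 hcore
  have h4 := (card_three_le_of_even
    (fun e => card_of_mem_oddEdges) (oddEdges_nonempty hne hcyc)
    (even_oddEdges_at h3)).1
  have h5 := card_edges_le (T := T)
  have h6 : 0 < #(verts T) := by
    obtain ⟨t, ht⟩ := hne
    obtain ⟨v, hv⟩ := card_pos.1 (show 0 < #t by rw [h3 t ht]; norm_num)
    exact card_pos.2 ⟨v, mem_verts.2 ⟨t, ht, hv⟩⟩
  have h8 : 8 ≤ #(verts T) := by
    by_contra hlt
    have h7 : #(oddEdges T) = 3 → #(verts T) ≠ 7 := not_card_verts_eq_seven h3 hne hcore hcyc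
    generalize #(verts T) = n at *
    generalize #(edges T) = m at *
    interval_cases n <;> simp [Nat.choose] at h5 <;> omega
  exact ⟨h8, by omega⟩

/-- A nonempty family of triangles without free edges that supports no cycle with coefficients in
`ℤ/2` has at least `8` vertices and at least `17` members. -/
theorem bounds (h3 : ∀ t ∈ T, #t = 3) (hne : T.Nonempty) (hcore : NoFreeEdge T)
    (hcyc : ∀ S ⊆ T, IsCycle S → S = ∅) : 8 ≤ #(verts T) ∧ 17 ≤ #T := by
  classical
  obtain ⟨S, hS, hmin⟩ := exists_min_image {S ∈ T.powerset | S.Nonempty ∧ NoFreeEdge S} card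
    ⟨T, mem_filter.2 ⟨mem_powerset_self T, hne, hcore⟩⟩
  simp only [mem_filter, mem_powerset] at hS hmin
  obtain ⟨hST, hSne, hScore⟩ := hS
  have h := bounds_of_minimal (fun t ht => h3 t (hST ht)) hSne hScore
    (fun R hR hRne hRcore => eq_of_subset_of_card_le hR (hmin R ⟨hR.trans hST, hRne, hRcore⟩))
    (fun R hR => hcyc R (hR.trans hST))
  exact ⟨h.1.trans (card_le_card (biUnion_subset_biUnion_of_subset_left _ hST)),
    h.2.trans (card_le_card hST)⟩

end TriangleFamily

end Counting

/-! ### Logarithms, sections and square roots on compact contractible spaces -/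

section Topological

open Topology unitInterval

section Homotopy

variable {X Y : Type*} [TopologicalSpace X] [TopologicalSpace Y] [CompactSpace X]
  [ContractibleSpace X]

/-- On a compact contractible space, a property of maps that holds for constant maps and is
invariant under small perturbations holds for all maps. -/
lemma ContinuousMap.of_contractible_of_perturbation (Q : C(X, Y) → Prop) {R : Set (Y × Y)}
    (hR : IsOpen R) (hdiag : ∀ y, (y, y) ∈ R)
    (hQ : ∀ g h : C(X, Y), (∀ x, (g x, h x) ∈ R) → Q g → Q h)
    (hconst : ∀ y, Q (ContinuousMap.const X y)) (f : C(X, Y)) : Q f := by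
  obtain ⟨y, ⟨H⟩⟩ := id_nullhomotopic X
  let F : C(I × X, Y) := f.comp H.toContinuousMap
  -- Compactness makes closeness uniform in x. Both orders are needed since `R` need not be
  -- symmetric: one gives closedness, the other openness of the set of good times.
  have hclose : ∀ t₀ : I, ∀ᶠ t in 𝓝 t₀, ∀ x, (F (t, x), F (t₀, x)) ∈ R ∧
      (F (t₀, x), F (t, x)) ∈ R := by
    intro t₀
    have h := (isCompact_univ (X := X)).eventually_forall_of_forall_eventually (x₀ := t₀)
      (P := fun t x => (F (t, x), F (t₀, x)) ∈ R ∧ (F (t₀, x), F (t, x)) ∈ R) (by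
        intro x _
        have h1 : Continuous fun z : I × X => (F (z.1, z.2), F (t₀, z.2)) :=
          Continuous.prodMk (F.continuous.comp (by fun_prop)) (F.continuous.comp (by fun_prop))
        have h2 : Continuous fun z : I × X => (F (t₀, z.2), F (z.1, z.2)) :=
          Continuous.prodMk (F.continuous.comp (by fun_prop)) (F.continuous.comp (by fun_prop))
        exact (h1.continuousAt.eventually_mem (hR.mem_nhds (hdiag _))).and
          (h2.continuousAt.eventually_mem (hR.mem_nhds (hdiag _))))
    simpa using h
  have hclopen : IsClopen {t : I | Q (F.curry t)} := by
    refine ⟨⟨isOpen_iff_mem_nhds.2 fun t ht => ?_⟩, isOpen_iff_mem_nhds.2 fun t ht => ?_⟩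
    · filter_upwards [hclose t] with t' h ht'
      exact ht (hQ (F.curry t') (F.curry t) (fun x => (h x).1) ht')
    · filter_upwards [hclose t] with t' h
      exact hQ (F.curry t) (F.curry t') (fun x => (h x).2) ht
  have huniv := (isClopen_iff.1 hclopen).resolve_left (by
    rw [← ne_eq, ← Set.nonempty_iff_ne_empty]
    refine ⟨1, ?_⟩
    have : F.curry 1 = ContinuousMap.const X (f y) := by
      ext x; simp [F]
    simpa only [Set.mem_ofPred_eq, this] using hconst (f y))
  have h0 : (0 : I) ∈ {t : I | Q (F.curry t)} := huniv ▸ Set.mem_univ _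
  have : F.curry 0 = f := by ext x; simp [F]
  simpa only [Set.mem_ofPred_eq, this] using h0

/-- Nonvanishing functions on a compact contractible space have logarithms. -/
lemma exists_continuous_exp_eq (f : C(X, ℂ)) (hf : ∀ x, f x ≠ 0) :
    ∃ L : C(X, ℂ), ∀ x, Complex.exp (L x) = f x := by
  let f' : C(X, {z : ℂ // z ≠ 0}) := ⟨fun x => ⟨f x, hf x⟩, by fun_prop⟩
  refine ContinuousMap.of_contractible_of_perturbation
    (Q := fun g : C(X, {z : ℂ // z ≠ 0}) => ∃ L : C(X, ℂ), ∀ x, Complex.exp (L x) = (g x).1)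
    (R := {p | p.2.1 / p.1.1 ∈ Complex.slitPlane}) ?_ ?_ ?_ ?_ f'
  · refine Complex.isOpen_slitPlane.preimage ?_
    exact Continuous.div (by fun_prop) (by fun_prop) fun p => p.1.2
  · intro y
    simp [div_self y.2]
  · rintro g h hgh ⟨L, hL⟩
    -- The quotient avoids the branch cut, so its principal logarithm corrects `L` continuously.
    refine ⟨⟨fun x => L x + Complex.log ((h x).1 / (g x).1), ?_⟩, fun x => ?_⟩
    · refine L.continuous.add (Continuous.clog ?_ hgh)
      exact Continuous.div (by fun_prop) (by fun_prop) fun x => (g x).2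
    · have : (h x).1 / (g x).1 ≠ 0 := div_ne_zero (h x).2 (g x).2
      simp only [ContinuousMap.coe_mk]
      rw [Complex.exp_add, hL, Complex.exp_log this, mul_div_cancel₀ _ (g x).2]
  · intro y
    exact ⟨ContinuousMap.const X (Complex.log y.1), fun x => by simp [Complex.exp_log y.2]⟩

open Matrix in
/-- A continuous field of nonzero idempotents on a compact contractible space has a nonvanishing
continuous section. -/
lemma exists_section_of_idempotent {n : Type*} [Fintype n] [DecidableEq n]
    (P : C(X, Matrix n n ℂ)) (hP : ∀ x, P x * P x = P x) (hP0 : ∀ x, P x ≠ 0) :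
    ∃ s : C(X, n → ℂ), ∀ x, s x ≠ 0 ∧ P x *ᵥ s x = s x := by
  let P' : C(X, {A : Matrix n n ℂ // A * A = A ∧ A ≠ 0}) :=
    ⟨fun x => ⟨P x, hP x, hP0 x⟩, by fun_prop⟩
  refine ContinuousMap.of_contractible_of_perturbation
    (Q := fun A : C(X, {A : Matrix n n ℂ // A * A = A ∧ A ≠ 0}) =>
      ∃ s : C(X, n → ℂ), ∀ x, s x ≠ 0 ∧ (A x).1 *ᵥ s x = s x)
    (R := {p | (1 - p.1.1 + p.2.1).det ≠ 0}) ?_ ?_ ?_ ?_ P'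
  · refine isOpen_ne.preimage (Continuous.matrix_det ?_)
    fun_prop
  · intro y; simp
  · rintro A B hAB ⟨s, hs⟩
    refine ⟨⟨fun x => (B x).1 *ᵥ s x, ?_⟩, fun x => ⟨fun h => ?_, ?_⟩⟩
    · exact Continuous.matrix_mulVec (by fun_prop) (by fun_prop)
    · simp only [ContinuousMap.coe_mk] at h
      -- On a vector s fixed by A, the invertible matrix 1 - A + B acts as B, so Bs = 0 would force
      -- s = 0.
      refine (hs x).1 (Matrix.eq_zero_of_mulVec_eq_zero (hAB x) ?_)
      rw [Matrix.add_mulVec, Matrix.sub_mulVec, Matrix.one_mulVec, (hs x).2, h]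
      simp
    · simp only [ContinuousMap.coe_mk, Matrix.mulVec_mulVec, (B x).2.1]
  · rintro ⟨A, hA, hA0⟩
    obtain ⟨v, hv⟩ : ∃ v, A *ᵥ v ≠ 0 := by
      by_contra! h
      apply hA0
      ext i j
      have := congrFun (h (Pi.single j 1)) i
      simpa using this
    exact ⟨ContinuousMap.const X (A *ᵥ v), fun x => ⟨hv, by simp [Matrix.mulVec_mulVec, hA]⟩⟩

end Homotopy

open Classical in
lemma continuousOn_dite {E F : Type*} [TopologicalSpace E] [TopologicalSpace F] {A : Set E}
    (f : C(A, F)) (y : F) : ContinuousOn (fun x => if h : x ∈ A then f ⟨x, h⟩ else y) A := by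
  rw [continuousOn_iff_continuous_domRestrict]
  convert f.continuous using 1
  ext x
  simp [Set.domRestrict]

/-- Nonvanishing functions on a compact convex set have square roots. -/
lemma exists_sqrt_of_convex {E : Type*} [AddCommGroup E] [Module ℝ E] [TopologicalSpace E]
    [ContinuousAdd E] [ContinuousSMul ℝ E] {A : Set E} (hA : Convex ℝ A) (hc : IsCompact A)
    (hne : A.Nonempty) {g : E → ℂ} (hg : ContinuousOn g A) (hg0 : ∀ x ∈ A, g x ≠ 0) :
    ∃ r : E → ℂ, ContinuousOn r A ∧ ∀ x ∈ A, r x ^ 2 = g x := by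
  classical
  have := hA.contractibleSpace hne
  have := isCompact_iff_compactSpace.1 hc
  obtain ⟨L, hL⟩ := exists_continuous_exp_eq ⟨A.domRestrict g, hg.domRestrict⟩ fun x => hg0 x x.2
  refine ⟨fun x => if h : x ∈ A then Complex.exp (L ⟨x, h⟩ / 2) else 0, ?_, fun x hx => ?_⟩
  · exact continuousOn_dite (f := ⟨fun x => Complex.exp (L x / 2), by fun_prop⟩) 0
  · have h := hL ⟨x, hx⟩
    simp only [hx, dite_true, ← Complex.exp_nat_mul]
    rw [← show Complex.exp (L ⟨x, hx⟩) = g x from h]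
    congr 1; push_cast; ring

end Topological

/-! ### Connectedness and 1-cocycles read off from the realization -/

section Realization

open Finset Topology unitInterval

namespace PreAbstractSimplicialComplex

variable {V : Type*}

/-- The closed simplex spanned by `s`, in barycentric coordinates. -/
def cell (s : Finset V) : Set (V → ℝ) :=
  {x | (∀ v, 0 ≤ x v) ∧ (∀ v, v ∉ s → x v = 0) ∧ ∑ v ∈ s, x v = 1}

lemma mem_realization {K : PreAbstractSimplicialComplex V} {x : V → ℝ} :
    x ∈ K.realization ↔ ∃ s ∈ K.faces, x ∈ cell s := by
  simp only [realization, cell, Set.mem_ofPred_eq]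
  constructor
  · rintro ⟨h, s, hs, h1, h2⟩; exact ⟨s, hs, h, h1, h2⟩
  · rintro ⟨s, hs, h, h1, h2⟩; exact ⟨h, s, hs, h1, h2⟩

lemma cell_subset_realization {K : PreAbstractSimplicialComplex V} {s : Finset V}
    (hs : s ∈ K.faces) : cell s ⊆ K.realization := fun _ hx => mem_realization.2 ⟨s, hs, hx⟩

lemma convex_cell (s : Finset V) : Convex ℝ (cell s) := by
  rintro x ⟨hx, hxs, hx1⟩ y ⟨hy, hys, hy1⟩ p q hp hq hpq
  refine ⟨fun v => ?_, fun v hv => ?_, ?_⟩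
  · have := hx v; have := hy v
    simp only [Pi.add_apply, Pi.smul_apply, smul_eq_mul]; positivity
  · simp [hxs v hv, hys v hv]
  · simp only [Pi.add_apply, Pi.smul_apply, smul_eq_mul, sum_add_distrib, ← mul_sum, hx1, hy1]
    simpa using hpq

lemma le_one_of_mem_cell {s : Finset V} {x : V → ℝ} (hx : x ∈ cell s) (v : V) : x v ≤ 1 := by
  by_cases hv : v ∈ s
  · rw [← hx.2.2]; exact single_le_sum (fun w _ => hx.1 w) hv
  · rw [hx.2.1 v hv]; exact zero_le_one

lemma isCompact_cell (s : Finset V) : IsCompact (cell s) := by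
  refine (isCompact_univ_pi (fun _ : V => isCompact_Icc (a := (0 : ℝ)) (b := 1))).of_isClosed_subset
    ?_ fun x hx v _ => ⟨hx.1 v, le_one_of_mem_cell hx v⟩
  have h1 : IsClosed {x : V → ℝ | ∀ v, 0 ≤ x v} := by
    simp only [Set.ofPred_forall]
    exact isClosed_iInter fun v => isClosed_le continuous_const (continuous_apply v)
  have h2 : IsClosed {x : V → ℝ | ∀ v, v ∉ s → x v = 0} := by
    simp only [Set.ofPred_forall]
    exact isClosed_iInter fun v => isClosed_iInter fun _ =>
      isClosed_eq (continuous_apply v) continuous_const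
  have h3 : IsClosed {x : V → ℝ | ∑ v ∈ s, x v = 1} :=
    isClosed_eq (by fun_prop) continuous_const
  exact h1.inter (h2.inter h3)

lemma isCompact_realization [Finite V] (K : PreAbstractSimplicialComplex V) :
    IsCompact K.realization := by
  have : K.realization = ⋃ s ∈ K.faces, cell s := by
    ext x; simp [mem_realization]
  rw [this]
  exact (Set.toFinite K.faces).isCompact_biUnion fun s _ => isCompact_cell s

lemma cell_mono {s t : Finset V} (h : s ⊆ t) : cell s ⊆ cell t := by
  rintro x ⟨h0, h1, h2⟩
  refine ⟨h0, fun v hv => h1 v fun hs => hv (h hs), ?_⟩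
  rw [← h2]
  exact (sum_subset h fun v _ hv => h1 v hv).symm

lemma exists_pos_of_mem_cell {s : Finset V} {x : V → ℝ} (hx : x ∈ cell s) : ∃ v, 0 < x v := by
  by_contra! h
  have := hx.2.2
  rw [sum_eq_zero fun v _ => le_antisymm (h v) (hx.1 v)] at this
  exact zero_ne_one this

lemma mem_of_pos {s : Finset V} {x : V → ℝ} (hx : x ∈ cell s) {v : V} (hv : 0 < x v) : v ∈ s := by
  by_contra h
  exact hv.ne' (hx.2.1 v h)

lemma exists_pos (K : PreAbstractSimplicialComplex V) (x : K.realization) :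
    ∃ v, 0 < x.1 v := by
  obtain ⟨s, -, hx⟩ := mem_realization.1 x.2
  exact exists_pos_of_mem_cell hx

/-- The open star of a vertex. -/
lemma eventually_pos (K : PreAbstractSimplicialComplex V) (x : K.realization) {v : V}
    (hv : 0 < x.1 v) : ∀ᶠ y : K.realization in 𝓝 x, 0 < y.1 v :=
  continuousAt_const.eventually_lt
    ((continuous_apply v).comp continuous_subtype_val).continuousAt hv

variable [DecidableEq V]

lemma single_mem_cell {s : Finset V} {v : V} (hv : v ∈ s) : (Pi.single v 1 : V → ℝ) ∈ cell s := by
  refine ⟨fun w => ?_, fun w hw => ?_, ?_⟩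
  · by_cases h : w = v
    · subst h; simp
    · simp [h]
  · have : w ≠ v := by rintro rfl; exact hw hv
    simp [this]
  · simp [Pi.single_apply, sum_ite_eq', hv]

/-- A function on the vertices of a complex with connected realization is constant if it is
constant on every face. -/
lemma vertices_eq_of_preconnected (K : PreAbstractSimplicialComplex V)
    [PreconnectedSpace K.realization] {A : Type*} (h : V → A)
    (hh : ∀ s ∈ K.faces, ∀ v ∈ s, ∀ w ∈ s, h v = h w) {v w : V} (hv : {v} ∈ K.faces)
    (hw : {w} ∈ K.faces) : h v = h w := by
  choose b hb using K.exists_pos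
  have hbase : ∀ (x : K.realization) (u : V), 0 < x.1 u → h (b x) = h u := by
    intro x u hu
    obtain ⟨s, hs, hx⟩ := mem_realization.1 x.2
    exact hh s hs _ (mem_of_pos hx (hb x)) _ (mem_of_pos hx hu)
  have hloc : IsLocallyConstant fun x => h (b x) := by
    rw [IsLocallyConstant.iff_eventually_eq]
    intro x
    filter_upwards [K.eventually_pos x (hb x)] with y hy
    exact hbase y _ hy
  have hpt : ∀ u, {u} ∈ K.faces → (Pi.single u 1 : V → ℝ) ∈ K.realization := fun u hu =>
    cell_subset_realization hu (single_mem_cell (mem_singleton_self u))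
  have := hloc.apply_eq_of_preconnectedSpace ⟨_, hpt v hv⟩ ⟨_, hpt w hw⟩
  rwa [hbase _ v (by simp), hbase _ w (by simp)] at this

/-- Logarithms of the constant function `1` are constant. -/
lemma _root_.eq_of_exp_eq_one {X : Type*} [TopologicalSpace X] [PreconnectedSpace X] {M : X → ℂ}
    (hM : Continuous M) (h : ∀ x, Complex.exp (M x) = 1) (x y : X) : M x = M y := by
  choose n hn using fun x => Complex.exp_eq_one_iff.1 (h x)
  have hc : Continuous n := by
    rw [Int.isClosedEmbedding_coe_real.isEmbedding.continuous_iff]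
    have : ((fun k : ℤ => (k : ℝ)) ∘ n) = fun x => (M x / (2 * Real.pi * Complex.I)).re := by
      ext x
      rw [hn x, mul_div_cancel_right₀ _ Complex.two_pi_I_ne_zero]; simp
    rw [this]
    exact Complex.continuous_re.comp (hM.div_const _)
  rw [hn x, hn y, PreconnectedSpace.constant inferInstance hc (x := x) (y := y)]

section
variable [Fintype V]

/-- The values at `x` of the circle-valued function of a cocycle do not depend on the base
vertex. -/
lemma exp_sum_eq (K : PreAbstractSimplicialComplex V) {c : V → V → ℤ}
    (hc : ∀ s ∈ K.faces, ∀ u ∈ s, ∀ v ∈ s, ∀ w ∈ s, c u v + c v w = c u w) {s : Finset V}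
    (hs : s ∈ K.faces) {x : V → ℝ} (hx : x ∈ cell s) {b b' : V} (hb : b ∈ s) (hb' : b' ∈ s) :
    Complex.exp (∑ v, x v * c b v * (2 * Real.pi * Complex.I)) =
      Complex.exp (∑ v, x v * c b' v * (2 * Real.pi * Complex.I)) := by
  rw [Complex.exp_eq_exp_iff_exists_int]
  -- By the cocycle rule the coefficients for b and b' differ by the constant c b b', and the
  -- barycentric coordinates sum to 1.
  refine ⟨c b b', ?_⟩
  have hsum : ∑ v, (x v : ℂ) = 1 := by
    have : ∑ v, x v = 1 := by
      rw [← hx.2.2]; exact (sum_subset (subset_univ s) fun v _ hv => hx.2.1 v hv).symm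
    exact_mod_cast congrArg (fun r : ℝ => (r : ℂ)) this
  have : (c b b' : ℂ) * (2 * Real.pi * Complex.I) =
      ∑ v, x v * c b b' * (2 * Real.pi * Complex.I) := by
    rw [← sum_mul, ← sum_mul, hsum, one_mul]
  rw [this, ← sum_add_distrib]
  refine sum_congr rfl fun v _ => ?_
  by_cases hv : v ∈ s
  · rw [← hc s hs b hb b' hb' v hv]; push_cast; ring
  · simp [hx.2.1 v hv]

/-- Integral `1`-cocycles of a complex with compact contractible realization are coboundaries. -/
lemma exists_eq_sub_of_cocycle (K : PreAbstractSimplicialComplex V)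
    [ContractibleSpace K.realization] {c : V → V → ℤ}
    (hc : ∀ s ∈ K.faces, ∀ u ∈ s, ∀ v ∈ s, ∀ w ∈ s, c u v + c v w = c u w) :
    ∃ g : V → ℤ, ∀ s ∈ K.faces, ∀ u ∈ s, ∀ v ∈ s, c u v = g v - g u := by
  have := isCompact_iff_compactSpace.1 K.isCompact_realization
  choose b hb using K.exists_pos
  -- The cocycle becomes a map to the circle. The base vertex `b x` may jump, but by `exp_sum_eq`
  -- the value at x does not depend on it. At vertices the map is 1, so its logarithm there is an
  -- integral multiple of 2πi; these integers form the potential.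
  let φ : V → (V → ℝ) → ℂ := fun u x =>
    Complex.exp (∑ v, x v * c u v * (2 * Real.pi * Complex.I))
  have hφ : ∀ u, Continuous (φ u) := fun u => by fun_prop
  have hbase : ∀ (x : K.realization) (s : Finset V), s ∈ K.faces → x.1 ∈ cell s → ∀ u ∈ s,
      φ (b x) x = φ u x := fun x s hs hx u hu =>
    K.exp_sum_eq hc hs hx (mem_of_pos hx (hb x)) hu
  have hf : Continuous fun x : K.realization => φ (b x) x := by
    rw [continuous_iff_continuousAt]
    intro x
    have h : ContinuousAt (fun y : K.realization => φ (b x) y) x :=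
      ((hφ (b x)).comp continuous_subtype_val).continuousAt
    refine h.congr ?_
    filter_upwards [K.eventually_pos x (hb x)] with y hy
    obtain ⟨s, hs, hys⟩ := mem_realization.1 y.2
    exact (hbase y s hs hys _ (mem_of_pos hys hy)).symm
  obtain ⟨L, hL⟩ := exists_continuous_exp_eq ⟨_, hf⟩ fun x => Complex.exp_ne_zero _
  simp only [ContinuousMap.coe_mk] at hL
  have hself : ∀ s ∈ K.faces, ∀ u ∈ s, c u u = 0 := fun s hs u hu => by
    have := hc s hs u hu u hu u hu
    omega
  have hpath : ∀ s ∈ K.faces, ∀ u ∈ s, ∀ v ∈ s,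
      ∃ (hu : (Pi.single u 1 : V → ℝ) ∈ K.realization)
        (hv : (Pi.single v 1 : V → ℝ) ∈ K.realization),
        L ⟨_, hv⟩ - L ⟨_, hu⟩ = c u v * (2 * Real.pi * Complex.I) := by
    intro s hs u hu v hv
    let γ : I → (V → ℝ) := fun t => (1 - t.1) • Pi.single u 1 + t.1 • Pi.single v 1
    have hγ : ∀ t, γ t ∈ cell s := fun t =>
      convex_cell s (single_mem_cell hu) (single_mem_cell hv) (by linarith [t.2.2]) t.2.1 (by ring)
    have hγK : ∀ t, γ t ∈ K.realization := fun t => cell_subset_realization hs (hγ t)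
    have hγc : Continuous γ := by fun_prop
    have hval : ∀ t, φ u (γ t) = Complex.exp (t.1 * c u v * (2 * Real.pi * Complex.I)) := by
      intro t
      have : ∑ w, (γ t w : ℂ) * c u w * (2 * Real.pi * Complex.I) =
          t.1 * c u v * (2 * Real.pi * Complex.I) := by
        have hcu := hself s hs u hu
        rw [sum_eq_single v]
        · rcases eq_or_ne v u with rfl | hvu
          · simp [hcu]
          · simp [γ, hvu]
        · intro w _ hw
          rcases eq_or_ne w u with rfl | hwu
          · simp [hcu]
          · simp [γ, hw, hwu]
        · simp
      simp only [φ, this]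
    -- Along the edge, `L` and the linear function with slope 2πi · c u v are logarithms of the same
    -- function, so their difference is constant.
    have hM := eq_of_exp_eq_one
      (M := fun t : I => L ⟨γ t, hγK t⟩ - t.1 * c u v * (2 * Real.pi * Complex.I))
      (by fun_prop) (by
        intro t
        rw [Complex.exp_sub, hL, hbase ⟨γ t, hγK t⟩ s hs (hγ t) u hu, hval]
        exact div_self (Complex.exp_ne_zero _)) 1 0
    refine ⟨cell_subset_realization hs (single_mem_cell hu),
      cell_subset_realization hs (single_mem_cell hv), ?_⟩
    have h0 : γ 0 = Pi.single u 1 := by simp [γ]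
    have h1 : γ 1 = Pi.single v 1 := by simp [γ]
    simp only [h0, h1, Set.Icc.coe_one, Set.Icc.coe_zero, sub_zero, Complex.ofReal_one, Complex.ofReal_zero, one_mul, zero_mul] at hM
    linear_combination hM
  have hint : ∀ v, ∃ n : ℤ, ∀ hv : (Pi.single v 1 : V → ℝ) ∈ K.realization,
      L ⟨_, hv⟩ = n * (2 * Real.pi * Complex.I) := by
    intro v
    by_cases hv : (Pi.single v 1 : V → ℝ) ∈ K.realization
    · obtain ⟨s, hs, hvs⟩ := mem_realization.1 hv
      have hvs' : v ∈ s := mem_of_pos hvs (by simp)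
      obtain ⟨n, hn⟩ := Complex.exp_eq_one_iff.1 (show Complex.exp (L ⟨_, hv⟩) = 1 by
        rw [hL, hbase ⟨_, hv⟩ s hs hvs v hvs']
        simp only [φ]
        rw [sum_eq_zero, Complex.exp_zero]
        intro w _
        by_cases hw : w = v
        · rw [hw, hself s hs v hvs']; simp
        · simp [hw])
      exact ⟨n, fun _ => hn⟩
    · exact ⟨0, fun h => absurd h hv⟩
  choose g hg using hint
  refine ⟨g, fun s hs u hu v hv => ?_⟩
  obtain ⟨h1, h2, h⟩ := hpath s hs u hu v hv
  rw [hg v h2, hg u h1, ← sub_mul] at h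
  have := mul_right_cancel₀ Complex.two_pi_I_ne_zero h
  exact_mod_cast this.symm

end

end PreAbstractSimplicialComplex

end Realization

/-! ### A function twisted around one triangle -/

section Cycles

open Finset Topology

namespace PreAbstractSimplicialComplex

variable {V : Type*}

/-- A complex polynomial in the barycentric coordinates of the triangle `{a, b, c}`: on each edge
it is the square of a linear function, with signs that do not match at the vertices. -/
noncomputable def twist (a b c : V) (x : V → ℝ) : ℂ :=
  x a ^ 2 + 2 * Complex.I * x b ^ 2 - x c ^ 2 + 2 * (1 + Complex.I) * (x a * x b) +
    2 * (Complex.I - 1) * (x b * x c) - 2 * Complex.I * (x c * x a)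

lemma continuous_twist (a b c : V) : Continuous (twist a b c) := by
  unfold twist; fun_prop

/-- Followed around the boundary, the linear roots in this and the next two lemmas run from 1 at a
to 1 + i at b, to i at c and back to -1 at a: the root changes sign. -/
lemma twist_of_right_eq_zero (a b : V) {c : V} {x : V → ℝ} (h : x c = 0) :
    twist a b c x = (x a + (1 + Complex.I) * x b) ^ 2 := by
  simp only [twist, h, Complex.ofReal_zero]
  linear_combination (-(x b : ℂ) ^ 2) * Complex.I_sq

lemma twist_of_left_eq_zero {a : V} (b c : V) {x : V → ℝ} (h : x a = 0) :
    twist a b c x = ((1 + Complex.I) * x b + Complex.I * x c) ^ 2 := by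
  simp only [twist, h, Complex.ofReal_zero]
  linear_combination (-((x b : ℂ) + x c) ^ 2) * Complex.I_sq

lemma twist_of_mid_eq_zero (a : V) {b : V} (c : V) {x : V → ℝ} (h : x b = 0) :
    twist a b c x = (Complex.I * x c - x a) ^ 2 := by
  simp only [twist, h, Complex.ofReal_zero]
  linear_combination (-(x c : ℂ) ^ 2) * Complex.I_sq

lemma twist_ne_zero {a b c : V} {x : V → ℝ} (hx : x a + x b + x c = 1)
    (h0 : x a = 0 ∨ x b = 0 ∨ x c = 0) : twist a b c x ≠ 0 := by
  intro h
  rcases h0 with h0 | h0 | h0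
  · rw [twist_of_left_eq_zero _ _ h0] at h
    have h := pow_eq_zero_iff (two_ne_zero) |>.1 h
    have h1 := congrArg Complex.re h
    have h2 := congrArg Complex.im h
    simp at h1 h2
    simp [h0, h1] at hx h2
    linarith
  · rw [twist_of_mid_eq_zero _ _ h0] at h
    have h := pow_eq_zero_iff (two_ne_zero) |>.1 h
    have h1 := congrArg Complex.re h
    have h2 := congrArg Complex.im h
    simp at h1 h2
    simp [h0, h1, h2] at hx
  · rw [twist_of_right_eq_zero _ _ h0] at h
    have h := pow_eq_zero_iff (two_ne_zero) |>.1 h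
    have h1 := congrArg Complex.re h
    have h2 := congrArg Complex.im h
    simp at h1 h2
    simp [h0, h2] at hx h1
    linarith

/-- The barycentric distance to the boundary of the triangle `{a, b, c}`. -/
noncomputable def depth (a b c : V) (x : V → ℝ) : ℝ := min (x a) (min (x b) (x c))

lemma depth_eq_zero {a b c : V} {x : V → ℝ} (h : ∀ v, 0 ≤ x v)
    (h0 : x a = 0 ∨ x b = 0 ∨ x c = 0) : depth a b c x = 0 := by
  apply le_antisymm
  · rcases h0 with h0 | h0 | h0 <;> simp [depth, h0]
  · simp [depth, h]

lemma eq_zero_of_depth_eq_zero {a b c : V} {x : V → ℝ} (h : depth a b c x = 0) :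
    x a = 0 ∨ x b = 0 ∨ x c = 0 := by
  simp only [depth] at h
  rcases min_choice (x a) (min (x b) (x c)) with h1 | h1
  · left; rw [← h1, h]
  · rcases min_choice (x b) (x c) with h2 | h2
    · right; left; rw [← h2, ← h1, h]
    · right; right; rw [← h2, ← h1, h]

variable [DecidableEq V]

lemma sum_eq_one_of_mem_cell {a b c : V} (hab : a ≠ b) (hac : a ≠ c) (hbc : b ≠ c) {x : V → ℝ}
    (hx : x ∈ cell {a, b, c}) : x a + x b + x c = 1 := by
  have := hx.2.2
  rw [sum_insert (by simp [hab, hac]), sum_insert (by simp [hbc]), sum_singleton] at this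
  linarith

lemma depth_eq_zero_of_not_subset {a b c : V} {s : Finset V} (hs : ¬ {a, b, c} ⊆ s)
    {x : V → ℝ} (hx : x ∈ cell s) : depth a b c x = 0 := by
  apply depth_eq_zero hx.1
  by_contra! h
  apply hs
  have hmem : ∀ v, x v ≠ 0 → v ∈ s := fun v hv => by
    by_contra hvs; exact hv (hx.2.1 v hvs)
  intro v
  simp only [mem_insert, mem_singleton]
  rintro (rfl | rfl | rfl)
  · exact hmem _ h.1
  · exact hmem _ h.2.1
  · exact hmem _ h.2.2

/-- On a compact contractible complex in which `{a, b, c}` is a facet, there is a function without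
zeros off the interior of `{a, b, c}` that differs from `twist a b c` on the boundary of
`{a, b, c}` by a factor extending to `{a, b, c}` without zeros. -/
lemma exists_extension_twist [Finite V] (K : PreAbstractSimplicialComplex V)
    [ContractibleSpace K.realization] {a b c : V} (hab : a ≠ b) (hac : a ≠ c) (hbc : b ≠ c)
    (habc : {a, b, c} ∈ K.faces) (hmax : ∀ s ∈ K.faces, {a, b, c} ⊆ s → s = {a, b, c}) :
    ∃ u lam : (V → ℝ) → ℂ, ContinuousOn u K.realization ∧ ContinuousOn lam (cell {a, b, c}) ∧
      (∀ x ∈ K.realization, depth a b c x = 0 → u x ≠ 0) ∧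
      ∀ x ∈ cell {a, b, c}, lam x ≠ 0 ∧ u x = lam x * twist a b c x := by
  classical
  have := isCompact_iff_compactSpace.1 K.isCompact_realization
  let z := twist a b c
  let d : (V → ℝ) → ℂ := fun x => depth a b c x
  let m : (V → ℝ) → ℂ := fun x => (1 - x a - x b - x c : ℝ)
  -- The square of `m` keeps `r` from vanishing away from the triangle; on the triangle `m` is zero.
  let r : (V → ℝ) → ℂ := fun x => z x * star (z x) + d x ^ 2 + m x ^ 2
  have hz : Continuous z := continuous_twist a b c
  have hd : Continuous d := by
    apply Complex.continuous_ofReal.comp; unfold depth; fun_prop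
  have hm : Continuous m := by fun_prop
  have hr : Continuous r := by fun_prop
  have hdm : ∀ x ∈ K.realization, d x * m x = 0 := by
    intro x hx
    obtain ⟨s, hs, hxs⟩ := mem_realization.1 hx
    by_cases h : {a, b, c} ⊆ s
    · rw [hmax s hs h] at hxs
      have : m x = 0 := by
        have := sum_eq_one_of_mem_cell hab hac hbc hxs
        simp only [m]
        rw [show 1 - x a - x b - x c = 0 by linarith, Complex.ofReal_zero]
      rw [this, mul_zero]
    · simp [d, depth_eq_zero_of_not_subset h hxs]
  have hr0 : ∀ x, r x = 0 → z x = 0 ∧ d x = 0 ∧ m x = 0 := by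
    intro x h
    have h' : Complex.normSq (z x) + depth a b c x ^ 2 + (1 - x a - x b - x c) ^ 2 = 0 := by
      have h2 : r x = ((Complex.normSq (z x) + depth a b c x ^ 2 +
          (1 - x a - x b - x c) ^ 2 : ℝ) : ℂ) := by
        simp only [r, d, m]
        rw [Complex.star_def, Complex.mul_conj]
        push_cast; ring
      rw [h2] at h
      exact_mod_cast h
    have h1 := Complex.normSq_nonneg (z x)
    have h2 := sq_nonneg (depth a b c x)
    have h3 := sq_nonneg (1 - x a - x b - x c)
    refine ⟨Complex.normSq_eq_zero.1 (by linarith), ?_, ?_⟩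
    · simp only [d]; rw [pow_eq_zero_iff two_ne_zero |>.1 (show depth a b c x ^ 2 = 0 by linarith)]
      simp
    · simp only [m]
      rw [pow_eq_zero_iff two_ne_zero |>.1 (show (1 - x a - x b - x c) ^ 2 = 0 by linarith)]
      simp
  have hrK : ∀ x, r x ≠ 0 := by
    intro x h
    obtain ⟨h1, h2, h3⟩ := hr0 x h
    have h3' : 1 - x a - x b - x c = 0 := Complex.ofReal_eq_zero.1 h3
    have h2' : depth a b c x = 0 := Complex.ofReal_eq_zero.1 h2
    exact twist_ne_zero (by linarith) (eq_zero_of_depth_eq_zero h2') h1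
  -- On the triangle this is the orthogonal projection onto the line of (z, d), elsewhere onto that
  -- of (1, 0). On the boundary d = 0 and z ≠ 0, so the two lines agree.
  let P : C(K.realization, Matrix (Fin 2) (Fin 2) ℂ) :=
    ⟨fun x => !![1 - d x ^ 2 / r x, z x * d x / r x; star (z x) * d x / r x, d x ^ 2 / r x], by
      refine continuous_matrix fun i j => ?_
      have h1 : Continuous fun x : K.realization => d x := hd.comp continuous_subtype_val
      have h2 : Continuous fun x : K.realization => z x := hz.comp continuous_subtype_val
      have h3 : Continuous fun x : K.realization => r x := hr.comp continuous_subtype_val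
      fin_cases i <;> fin_cases j <;> simp
      · exact continuous_const.sub ((h1.pow 2).div h3 fun x => hrK x)
      · exact (h2.mul h1).div h3 fun x => hrK x
      · exact ((Complex.continuous_conj.comp h2).mul h1).div h3 fun x => hrK x
      · exact (h1.pow 2).div h3 fun x => hrK x⟩
  have hP : ∀ x, P x * P x = P x := by
    intro x
    have h1 := hdm x x.2
    have h2 := hrK x
    have h3 : r x = z x * star (z x) + d x ^ 2 + m x ^ 2 := rfl
    have h4 : d x ^ 2 * m x ^ 2 = 0 := by rw [← mul_pow, h1]; ring
    have h5 : z x * d x / r x * (star (z x) * d x / r x) = d x ^ 2 / r x - (d x ^ 2 / r x) ^ 2 := by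
      field_simp
      linear_combination (-(d x) ^ 2) * h3 - h4
    ext i j
    fin_cases i <;> fin_cases j <;> simp [P, Matrix.mul_apply, Fin.sum_univ_two] <;>
      simp only [Complex.star_def] at h5
    · linear_combination h5
    · ring
    · ring
    · linear_combination h5
  have hP0 : ∀ x, P x ≠ 0 := by
    intro x h
    have h1 := congrFun (congrFun h 0) 0
    have h2 := congrFun (congrFun h 1) 1
    simp [P] at h1 h2
    rcases h2 with h2 | h2
    · simp [h2] at h1
    · exact hrK x h2
  obtain ⟨s, hs⟩ := exists_section_of_idempotent P hP hP0
  -- On the triangle the section is a multiple of (z, d); the factor is recovered by an inner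
  -- product.
  let lam' : C(K.realization, ℂ) :=
    ⟨fun x => (star (z x) * s x 0 + d x * s x 1) / r x, by
      have h1 : Continuous fun x : K.realization => d x := hd.comp continuous_subtype_val
      have h2 : Continuous fun x : K.realization => z x := hz.comp continuous_subtype_val
      have h3 : Continuous fun x : K.realization => r x := hr.comp continuous_subtype_val
      exact (((Complex.continuous_conj.comp h2).mul (by fun_prop)).add
        (h1.mul (by fun_prop))).div h3 fun x => hrK x⟩
  let s0 : C(K.realization, ℂ) := ⟨fun x => s x 0, by fun_prop⟩
  have heq : ∀ x : K.realization,
      (1 - d x ^ 2 / r x) * s x 0 + z x * d x / r x * s x 1 = s x 0 ∧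
      star (z x) * d x / r x * s x 0 + d x ^ 2 / r x * s x 1 = s x 1 := by
    intro x
    have h := (hs x).2
    have h0 := congrFun h 0
    have h1 := congrFun h 1
    simp [P, Matrix.mulVec, dotProduct, Fin.sum_univ_two] at h0 h1
    exact ⟨h0, h1⟩
  have hne : ∀ x : K.realization, s x 0 = 0 → s x 1 = 0 → False := by
    intro x h0 h1
    apply (hs x).1
    ext i; fin_cases i <;> simp [h0, h1]
  refine ⟨fun x => if h : x ∈ K.realization then s0 ⟨x, h⟩ else 0,
    fun x => if h : x ∈ K.realization then lam' ⟨x, h⟩ else 0, continuousOn_dite s0 0,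
    (continuousOn_dite lam' 0).mono (cell_subset_realization habc), ?_, ?_⟩
  · intro x hx hd0
    have hd0' : d x = 0 := by simp [d, hd0]
    obtain ⟨-, h1⟩ := heq ⟨x, hx⟩
    simp only [hd0'] at h1
    simp only [hx, dite_true, s0, ContinuousMap.coe_mk]
    intro h0
    refine hne ⟨x, hx⟩ h0 ?_
    rw [← h1]; simp
  · intro x hx
    have hxK := cell_subset_realization habc hx
    have hm0 : m x = 0 := by
      have := sum_eq_one_of_mem_cell hab hac hbc hx
      simp only [m]
      rw [show 1 - x a - x b - x c = 0 by linarith, Complex.ofReal_zero]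
    obtain ⟨h0, h1⟩ := heq ⟨x, hxK⟩
    have h2 := hrK x
    have h3 : r x = z x * star (z x) + d x ^ 2 := by simp [r, hm0]
    simp only [hxK, dite_true, s0, lam', ContinuousMap.coe_mk] at h0 h1 ⊢
    have e1 : s ⟨x, hxK⟩ 1 =
        (star (z x) * s ⟨x, hxK⟩ 0 + d x * s ⟨x, hxK⟩ 1) / r x * d x := by
      field_simp at h1 ⊢
      linear_combination -h1
    have e0 : s ⟨x, hxK⟩ 0 =
        (star (z x) * s ⟨x, hxK⟩ 0 + d x * s ⟨x, hxK⟩ 1) / r x * z x := by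
      field_simp at h0 ⊢
      linear_combination -h0 + (s ⟨x, hxK⟩ 0) * h3
    refine ⟨fun h => ?_, e0⟩
    rw [h, zero_mul] at e0 e1
    exact hne _ e0 e1

end PreAbstractSimplicialComplex

/-! ### Edge signs and the absence of cycles mod 2 -/

namespace PreAbstractSimplicialComplex

variable {V : Type*} [DecidableEq V]

lemma prod_powersetCard_two_triple {M : Type*} [CommMonoid M] {a b c : V} (hab : a ≠ b)
    (hac : a ≠ c) (hbc : b ≠ c) (f : Finset V → M) :
    ∏ e ∈ powersetCard 2 {a, b, c}, f e = f {a, b} * f {a, c} * f {b, c} := by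
  rw [TriangleFamily.powersetCard_two_triple hab hac hbc]
  have h1 : ({a, b} : Finset V) ∉ ({{a, c}, {b, c}} : Finset (Finset V)) := by
    simp only [mem_insert, mem_singleton, not_or]
    constructor
    · intro h; have := h ▸ mem_insert_of_mem (a := b) (b := a) (mem_singleton_self b)
      simp at this; tauto
    · intro h; have := h ▸ mem_insert_self a {b}
      simp at this; tauto
  have h2 : ({a, c} : Finset V) ∉ ({{b, c}} : Finset (Finset V)) := by
    simp only [mem_singleton]
    intro h; have := h ▸ mem_insert_self a {c}
    simp at this; tauto
  rw [prod_insert h1, prod_insert h2, prod_singleton, mul_assoc]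

/-- The product of the vertex values of a square root on an edge does not depend on the root. -/
lemma prod_sqrt_eq {e : Finset V} (he : #e = 2) {u r r' : (V → ℝ) → ℂ}
    (hr : ContinuousOn r (cell e)) (hr' : ContinuousOn r' (cell e))
    (hru : ∀ x ∈ cell e, r x ^ 2 = u x) (hru' : ∀ x ∈ cell e, r' x ^ 2 = u x)
    (hu : ∀ x ∈ cell e, u x ≠ 0) :
    ∏ p ∈ e, r (Pi.single p 1) = ∏ p ∈ e, r' (Pi.single p 1) := by
  have hne : ∀ {x}, x ∈ cell e → r' x ≠ 0 := fun {x} hx h => by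
    apply hu x hx; rw [← hru' x hx, h]; simp
  -- Two roots differ by one global sign, which cancels over the two endpoints.
  rcases (convex_cell e).isPreconnected.eq_or_eq_neg_of_sq_eq hr hr'
    (fun x hx => by simp [hru x hx, hru' x hx]) hne with h | h
  · exact prod_congr rfl fun p hp => h (single_mem_cell hp)
  · rw [prod_congr rfl fun p hp => h (single_mem_cell hp)]
    simp [prod_neg, he]

lemma prod_edges_prod {t : Finset V} (ht : #t = 3) (w : V → ℂ) :
    ∏ e ∈ powersetCard 2 t, ∏ p ∈ e, w p = (∏ p ∈ t, w p) ^ 2 := by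
  obtain ⟨a, b, c, hab, hac, hbc, rfl⟩ := card_eq_three.1 ht
  rw [prod_powersetCard_two_triple hab hac hbc, prod_pair hab, prod_pair hac, prod_pair hbc,
    prod_insert (by simp [hab, hac]), prod_insert (by simp [hbc]), prod_singleton]
  ring

/-- The product over the triangles of a cycle of the edge signs is trivial. -/
lemma prod_cycle {T : Finset (Finset V)} (hT : TriangleFamily.IsCycle T) {κ : Finset V → ℂ}
    (hκ : ∀ e ∈ TriangleFamily.edges T, κ e ^ 2 = 1) :
    ∏ t ∈ T, ∏ e ∈ powersetCard 2 t, κ e = 1 := by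
  have h : ∀ t ∈ T, ∏ e ∈ powersetCard 2 t, κ e =
      ∏ e ∈ TriangleFamily.edges T, if e ⊆ t then κ e else 1 := by
    intro t ht
    rw [← prod_filter]
    congr 1
    ext e
    simp only [mem_filter, TriangleFamily.mem_edges, mem_powersetCard]
    constructor
    · rintro ⟨h1, h2⟩; exact ⟨⟨h2, t, ht, h1⟩, h1⟩
    · tauto
  rw [prod_congr rfl h, prod_comm]
  refine prod_eq_one fun e he => ?_
  rw [← prod_filter, prod_const]
  obtain ⟨k, hk⟩ := hT e (TriangleFamily.mem_edges.1 he).1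
  rw [show #{t ∈ T | e ⊆ t} = k + k from hk, ← two_mul, pow_mul, hκ e he, one_pow]

/-- A contractible complex of dimension at most two carries no cycle with coefficients
in `ℤ/2`. -/
theorem eq_empty_of_isCycle [Finite V] (K : PreAbstractSimplicialComplex V)
    [ContractibleSpace K.realization] (hdim : ∀ s ∈ K.faces, #s ≤ 3) {T : Finset (Finset V)}
    (hTK : ∀ t ∈ T, t ∈ K.faces) (hT3 : ∀ t ∈ T, #t = 3) (hT : TriangleFamily.IsCycle T) :
    T = ∅ := by
  by_contra hne
  obtain ⟨τ, hτ⟩ := nonempty_iff_ne_empty.2 hne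
  obtain ⟨a, b, c, hab, hac, hbc, rfl⟩ := card_eq_three.1 (hT3 τ hτ)
  obtain ⟨u, lam, huc, hlamc, hu0, hlam⟩ := K.exists_extension_twist hab hac hbc (hTK _ hτ)
    (fun s hs h => (eq_of_subset_of_card_le h (by rw [hT3 _ hτ]; exact hdim s hs)).symm)
  have hface : ∀ s ∈ K.faces, ¬ {a, b, c} ⊆ s →
      ContinuousOn u (cell s) ∧ ∀ x ∈ cell s, u x ≠ 0 := fun s hs h =>
    ⟨huc.mono (cell_subset_realization hs), fun x hx =>
      hu0 x (cell_subset_realization hs hx) (depth_eq_zero_of_not_subset h hx)⟩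
  have hsqrt : ∀ s, ∃ r : (V → ℝ) → ℂ, s ∈ K.faces → ¬ {a, b, c} ⊆ s →
      ContinuousOn r (cell s) ∧ ∀ x ∈ cell s, r x ^ 2 = u x := by
    intro s
    by_cases h : s ∈ K.faces ∧ ¬ {a, b, c} ⊆ s
    · obtain ⟨v, hv⟩ := (K.isRelLowerSet_faces h.1).1
      obtain ⟨h1, h2⟩ := hface s h.1 h.2
      obtain ⟨r, hr⟩ := exists_sqrt_of_convex (convex_cell s) (isCompact_cell s)
        ⟨_, single_mem_cell hv⟩ h1 h2
      exact ⟨r, fun _ _ => hr⟩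
    · exact ⟨0, fun h1 h2 => absurd ⟨h1, h2⟩ h⟩
  choose R hR using hsqrt
  choose σ hσ using fun p : V =>
    IsAlgClosed.exists_pow_nat_eq (u (Pi.single p 1)) (n := 2) two_pos
  have hnot : ∀ e : Finset V, #e = 2 → ¬ {a, b, c} ⊆ e := fun e he h => by
    have := card_le_card h
    rw [hT3 _ hτ, he] at this
    omega
  have hedge : ∀ e ∈ TriangleFamily.edges T, e ∈ K.faces := by
    intro e he
    obtain ⟨h2, t, ht, het⟩ := TriangleFamily.mem_edges.1 he
    exact (K.isRelLowerSet_faces (hTK t ht)).2 het (card_pos.1 (by omega))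
  have hvert : ∀ t ∈ T, ∀ p ∈ t, u (Pi.single p 1) ≠ 0 := by
    intro t ht p hp
    have hpK : {p} ∈ K.faces :=
      (K.isRelLowerSet_faces (hTK t ht)).2 (singleton_subset_iff.2 hp) (singleton_nonempty p)
    refine (hface {p} hpK fun h => ?_).2 _ (single_mem_cell (mem_singleton_self p))
    have := card_le_card h
    rw [hT3 _ hτ, card_singleton] at this
    omega
  -- The sign records whether the root on e matches the chosen roots `σ` at both ends or at neither
  -- (1), or at just one (-1).
  let κ : Finset V → ℂ := fun e => ∏ p ∈ e, R e (Pi.single p 1) / σ p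
  have hκ : ∀ e ∈ TriangleFamily.edges T, κ e ^ 2 = 1 := by
    intro e he
    obtain ⟨h2, t, ht, het⟩ := TriangleFamily.mem_edges.1 he
    rw [← prod_pow]
    refine prod_eq_one fun p hp => ?_
    rw [div_pow, (hR e (hedge e he) (hnot e h2)).2 _ (single_mem_cell hp), hσ]
    exact div_self (hvert t ht p (het hp))
  have hκ' : ∀ e ∈ TriangleFamily.edges T, ∀ r : (V → ℝ) → ℂ, ContinuousOn r (cell e) →
      (∀ x ∈ cell e, r x ^ 2 = u x) → κ e = ∏ p ∈ e, r (Pi.single p 1) / σ p := by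
    intro e he r hr hru
    have h2 := (TriangleFamily.mem_edges.1 he).1
    obtain ⟨h3, h4⟩ := hR e (hedge e he) (hnot e h2)
    simp only [κ, prod_div_distrib]
    rw [prod_sqrt_eq h2 h3 hr h4 hru (hface e (hedge e he) (hnot e h2)).2]
  -- A single root on the whole of t serves all three edges, and each vertex lies on two of them.
  have hone : ∀ t ∈ T, t ≠ {a, b, c} → ∏ e ∈ powersetCard 2 t, κ e = 1 := by
    intro t ht hne
    obtain ⟨h3, h4⟩ := hR t (hTK t ht) fun h =>
      hne (eq_of_subset_of_card_le h (by rw [hT3 _ hτ, hT3 t ht])).symm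
    have : ∀ e ∈ powersetCard 2 t, κ e = ∏ p ∈ e, R t (Pi.single p 1) / σ p := by
      intro e he
      obtain ⟨het, he2⟩ := mem_powersetCard.1 he
      exact hκ' e (TriangleFamily.mem_edges.2 ⟨he2, t, ht, het⟩) _ (h3.mono (cell_mono het))
        fun x hx => h4 x (cell_mono het hx)
    rw [prod_congr rfl this, prod_edges_prod (hT3 t ht), ← prod_pow]
    refine prod_eq_one fun p hp => ?_
    rw [div_pow, h4 _ (single_mem_cell hp), hσ]
    exact div_self (hvert t ht p hp)
  -- The factor lam has a root on the whole triangle and contributes nothing. The linear roots of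
  -- `twist` have vertex values with product 2i, while `twist` itself has product -2i over the three
  -- vertices.
  have hneg : ∏ e ∈ powersetCard 2 {a, b, c}, κ e = -1 := by
    obtain ⟨ρ, hρc, hρ⟩ := exists_sqrt_of_convex (convex_cell {a, b, c}) (isCompact_cell _)
      ⟨_, single_mem_cell (mem_insert_self a _)⟩ hlamc fun x hx => (hlam x hx).1
    have key : ∀ e ⊆ {a, b, c}, #e = 2 → ∀ S : (V → ℝ) → ℂ, Continuous S →
        (∀ x ∈ cell e, S x ^ 2 = twist a b c x) →
        κ e = ∏ p ∈ e, ρ (Pi.single p 1) * S (Pi.single p 1) / σ p := by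
      intro e he he2 S hS hSt
      refine hκ' e (TriangleFamily.mem_edges.2 ⟨he2, _, hτ, he⟩) (fun x => ρ x * S x)
        ((hρc.mono (cell_mono he)).mul hS.continuousOn) fun x hx => ?_
      rw [mul_pow, hρ x (cell_mono he hx), hSt x hx, (hlam x (cell_mono he hx)).2]
    have sab : ({a, b} : Finset V) ⊆ {a, b, c} := by intro x; simp; tauto
    have sac : ({a, c} : Finset V) ⊆ {a, b, c} := by intro x; simp; tauto
    have sbc : ({b, c} : Finset V) ⊆ {a, b, c} := by intro x; simp; tauto
    have kab := key {a, b} sab (card_pair hab) (fun x => x a + (1 + Complex.I) * x b)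
      (by fun_prop) fun x hx => (twist_of_right_eq_zero a b (hx.2.1 c (by simp; tauto))).symm
    have kac := key {a, c} sac (card_pair hac) (fun x => Complex.I * x c - x a)
      (by fun_prop) fun x hx => (twist_of_mid_eq_zero a c (hx.2.1 b (by simp; tauto))).symm
    have kbc := key {b, c} sbc (card_pair hbc) (fun x => (1 + Complex.I) * x b + Complex.I * x c)
      (by fun_prop) fun x hx => (twist_of_left_eq_zero b c (hx.2.1 a (by simp; tauto))).symm
    rw [prod_pair hab] at kab
    rw [prod_pair hac] at kac
    rw [prod_pair hbc] at kbc
    have hv : ∀ p ∈ ({a, b, c} : Finset V),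
        σ p ^ 2 = ρ (Pi.single p 1) ^ 2 * twist a b c (Pi.single p 1) := fun p hp => by
      rw [hσ, hρ _ (single_mem_cell hp), (hlam _ (single_mem_cell hp)).2]
    have va := hv a (by simp)
    have vb := hv b (by simp)
    have vc := hv c (by simp)
    have na : σ a ≠ 0 := fun h => hvert _ hτ a (by simp) (by rw [← hσ, h]; simp)
    have nb : σ b ≠ 0 := fun h => hvert _ hτ b (by simp) (by rw [← hσ, h]; simp)
    have nc : σ c ≠ 0 := fun h => hvert _ hτ c (by simp) (by rw [← hσ, h]; simp)
    simp [twist, hab, hac, hbc, hab.symm, hac.symm, hbc.symm] at va vb vc kab kac kbc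
    rw [prod_powersetCard_two_triple hab hac hbc, kab, kac, kbc]
    field_simp
    rw [va, vb, vc]
    ring_nf
    simp only [Complex.I_sq, show Complex.I ^ 3 = -Complex.I by
      rw [pow_succ, Complex.I_sq]; ring, show Complex.I ^ 4 = 1 from Complex.I_pow_four]
    ring
  have h1 := prod_cycle hT hκ
  rw [prod_eq_single_of_mem _ hτ hone, hneg] at h1
  norm_num at h1

end PreAbstractSimplicialComplex

end Cycles

/-! ### Collapsing a complex without a core -/

section Collapsing

open Finset

namespace PreAbstractSimplicialComplex

variable {V : Type*}

/-- Functions that are constant on every face are constant. -/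
def IsConnected (K : PreAbstractSimplicialComplex V) : Prop :=
  ∀ h : V → Prop, (∀ s ∈ K.faces, ∀ v ∈ s, ∀ w ∈ s, (h v ↔ h w)) →
    ∀ v w, {v} ∈ K.faces → {w} ∈ K.faces → (h v ↔ h w)

/-- `c` is an integral `1`-cocycle. -/
def IsCocycle (K : PreAbstractSimplicialComplex V) (c : V → V → ℤ) : Prop :=
  ∀ s ∈ K.faces, ∀ u ∈ s, ∀ v ∈ s, ∀ w ∈ s, c u v + c v w = c u w

/-- Integral `1`-cocycles are coboundaries. -/
def CocyclesTrivial (K : PreAbstractSimplicialComplex V) : Prop :=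
  ∀ c, K.IsCocycle c → ∃ g : V → ℤ, ∀ s ∈ K.faces, ∀ u ∈ s, ∀ v ∈ s, c u v = g v - g u

lemma mem_of_subset {K : PreAbstractSimplicialComplex V} {s t : Finset V} (ht : t ∈ K.faces)
    (hst : s ⊆ t) (hs : s.Nonempty) : s ∈ K.faces := (K.isRelLowerSet_faces ht).2 hst hs

/-- Removal of a face that lies in a single larger face, together with that face. -/
def removeFree (K : PreAbstractSimplicialComplex V) (s t : Finset V) (hst : s ⊆ t)
    (h : ∀ u ∈ K.faces, s ⊆ u → u = s ∨ u = t) : PreAbstractSimplicialComplex V where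
  faces := K.faces \ {s, t}
  isRelLowerSet_faces := by
    rintro u ⟨hu, hust⟩
    refine ⟨(K.isRelLowerSet_faces hu).1, fun v hvu hv => ⟨mem_of_subset hu hvu hv, ?_⟩⟩
    rintro (rfl | rfl)
    · exact hust (h u hu hvu)
    · exact hust (h u hu (hst.trans hvu))

lemma singleton_mem {K : PreAbstractSimplicialComplex V} {s : Finset V} (hs : s ∈ K.faces) {v : V}
    (hv : v ∈ s) : {v} ∈ K.faces :=
  mem_of_subset hs (singleton_subset_iff.2 hv) (singleton_nonempty v)

lemma IsCollapsible.of_removeFree [Finite V] {K : PreAbstractSimplicialComplex V} {s t : Finset V}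
    (hs : s ∈ K.faces) (ht : t ∈ K.faces) (hst : s ⊆ t) (hcard : #t = #s + 1)
    (h : ∀ u ∈ K.faces, s ⊆ u → u = s ∨ u = t) (hL : (K.removeFree s t hst h).IsCollapsible) :
    K.IsCollapsible := by
  obtain ⟨M, v, hM, hMv⟩ := hL
  refine ⟨M, v, Relation.ReflTransGen.head ⟨s, t, ⟨hs, ⟨ht, hst, hcard⟩, ?_⟩, rfl⟩ hM, hMv⟩
  rintro u ⟨hu, hsu, hucard⟩
  refine (h u hu hsu).resolve_left ?_
  rintro rfl
  omega

lemma ncard_removeFree_lt [Finite V] {K : PreAbstractSimplicialComplex V} {s t : Finset V}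
    (hs : s ∈ K.faces) (hst : s ⊆ t) (h : ∀ u ∈ K.faces, s ⊆ u → u = s ∨ u = t) :
    (K.removeFree s t hst h).faces.ncard < K.faces.ncard := by
  refine Set.ncard_lt_ncard ⟨Set.sdiff_subset, fun hsub => ?_⟩ (Set.toFinite _)
  exact (hsub hs).2 (Or.inl rfl)

variable [DecidableEq V]

lemma pair_mem {K : PreAbstractSimplicialComplex V} {s : Finset V} (hs : s ∈ K.faces) {v w : V}
    (hv : v ∈ s) (hw : w ∈ s) : {v, w} ∈ K.faces :=
  mem_of_subset hs (by intro x; simp only [mem_insert, mem_singleton]; rintro (rfl | rfl) <;>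
    assumption) ⟨v, by simp⟩

/-- The edge graph of a complex. -/
def graph (K : PreAbstractSimplicialComplex V) : SimpleGraph {v // {v} ∈ K.faces} where
  Adj x y := x ≠ y ∧ {x.1, y.1} ∈ K.faces
  symm := ⟨fun x y h => ⟨h.1.symm, by rw [pair_comm]; exact h.2⟩⟩
  loopless := ⟨fun x h => h.1 rfl⟩

lemma graph_preconnected {K : PreAbstractSimplicialComplex V} (hK : K.IsConnected) :
    K.graph.Preconnected := by
  intro v w
  have h := hK (fun x => ∃ hx : {x} ∈ K.faces, K.graph.Reachable v ⟨x, hx⟩) (by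
    have key : ∀ s ∈ K.faces, ∀ p ∈ s, ∀ q ∈ s,
        (∃ hx : {p} ∈ K.faces, K.graph.Reachable v ⟨p, hx⟩) →
        ∃ hx : {q} ∈ K.faces, K.graph.Reachable v ⟨q, hx⟩ := by
      rintro s hs p hp q hq ⟨hx, hr⟩
      refine ⟨singleton_mem hs hq, ?_⟩
      by_cases hpq : p = q
      · subst hpq; exact hr
      · refine hr.trans (SimpleGraph.Adj.reachable ⟨fun h => hpq (congrArg Subtype.val h), ?_⟩)
        exact pair_mem hs hp hq
    exact fun s hs p hp q hq => ⟨key s hs p hp q hq, key s hs q hq p hp⟩) v w v.2 w.2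
  exact (h.1 ⟨v.2, SimpleGraph.Reachable.refl _⟩).2

/-- In dimension one the signed indicator of an edge is a cocycle. Its potential is constant along
walks that avoid this edge yet differs at its ends, so every edge is a bridge. -/
lemma graph_isAcyclic {K : PreAbstractSimplicialComplex V} (hK : K.CocyclesTrivial)
    (hdim : ∀ s ∈ K.faces, #s ≤ 2) : K.graph.IsAcyclic := by
  rw [SimpleGraph.isAcyclic_iff_forall_adj_isBridge]
  intro u v huv
  rw [SimpleGraph.isBridge_iff]
  have huv' : u.1 ≠ v.1 := fun h => huv.1 (Subtype.ext h)
  let c : V → V → ℤ := fun x y =>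
    if x = u.1 ∧ y = v.1 then 1 else if x = v.1 ∧ y = u.1 then -1 else 0
  have hself : ∀ x, c x x = 0 := by intro x; simp only [c]; grind
  have hanti : ∀ x y, c x y + c y x = 0 := by intro x y; simp only [c]; grind
  obtain ⟨g, hg⟩ := hK c (by
    intro s hs p hp q hq r hr
    have : p = q ∨ q = r ∨ p = r := by
      by_contra! h
      have h3 : #({p, q, r} : Finset V) = 3 := card_eq_three.2 ⟨p, q, r, h.1, h.2.2, h.2.1, rfl⟩
      have hsub : {p, q, r} ⊆ s := by
        intro x; simp only [mem_insert, mem_singleton]; rintro (rfl | rfl | rfl) <;> assumption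
      have := card_le_card hsub
      have := hdim s hs
      omega
    rcases this with rfl | rfl | rfl
    · rw [hself, zero_add]
    · rw [hself, add_zero]
    · rw [hself, hanti])
  rintro ⟨w⟩
  have hw : ∀ {x y : {v // {v} ∈ K.faces}}, (K.graph.deleteEdges {s(u, v)}).Walk x y →
      g x.1 = g y.1 := by
    intro x y w
    induction w with
    | nil => rfl
    | @cons x y z hxy _ ih =>
      rw [← ih]
      rw [SimpleGraph.deleteEdges_adj] at hxy
      have h1 := hg _ hxy.1.2 x.1 (by simp) y.1 (by simp)
      have h0 : c x.1 y.1 = 0 := by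
        have h2 := hxy.2
        simp only [Set.mem_singleton_iff, Sym2.eq_iff, not_or, not_and, Subtype.ext_iff] at h2
        simp only [c]
        grind
      omega
  have h1 := hg _ huv.2 u.1 (by simp) v.1 (by simp)
  have h2 := hw w
  have h3 : c u.1 v.1 = 1 := by simp [c]
  omega

/-- A connected complex of dimension one without cycles has a leaf. -/
lemma exists_leaf [Finite V] {K : PreAbstractSimplicialComplex V} (hconn : K.IsConnected)
    (hK : K.CocyclesTrivial) (hdim : ∀ s ∈ K.faces, #s ≤ 2) {e : Finset V} (he : e ∈ K.faces)
    (he2 : #e = 2) :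
    ∃ v w, v ≠ w ∧ {v, w} ∈ K.faces ∧ ∀ x, v ≠ x → {v, x} ∈ K.faces → x = w := by
  classical
  have := Fintype.ofFinite {v // {v} ∈ K.faces}
  obtain ⟨a, b, hab, rfl⟩ := card_eq_two.1 he2
  have ha : {a} ∈ K.faces := singleton_mem he (by simp)
  have hb : {b} ∈ K.faces := singleton_mem he (by simp)
  have : Nontrivial {v // {v} ∈ K.faces} :=
    ⟨⟨a, ha⟩, ⟨b, hb⟩, fun h => hab (congrArg Subtype.val h)⟩
  have htree : K.graph.IsTree :=
    ⟨⟨graph_preconnected hconn⟩, graph_isAcyclic hK hdim⟩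
  obtain ⟨v, hv⟩ := htree.exists_vert_degree_one_of_nontrivial
  rw [SimpleGraph.degree_eq_one_iff_existsUnique_adj] at hv
  obtain ⟨w, hw, huniq⟩ := hv
  refine ⟨v, w, fun h => hw.1 (Subtype.ext h), hw.2, fun x hvx hx => ?_⟩
  exact congrArg Subtype.val (huniq ⟨x, singleton_mem hx (by simp)⟩
    ⟨fun h => hvx (congrArg Subtype.val h), hx⟩)

lemma mem_or_subset_of_remove_triangle {K L : PreAbstractSimplicialComplex V} {u v w : V}
    (hL : L.faces = K.faces \ {{u, v}, {u, v, w}}) {s : Finset V} (hs : s ∈ K.faces) :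
    s ∈ L.faces ∨ s ⊆ {u, v, w} := by
  by_cases h : s ∈ ({{u, v}, {u, v, w}} : Set (Finset V))
  · right
    rcases h with rfl | h
    · intro x; simp; tauto
    · rw [show s = _ from h]
  · left; rw [hL]; exact ⟨hs, h⟩

section removeTriangle

variable {K : PreAbstractSimplicialComplex V} {u v w : V} (huv : u ≠ v) (huw : u ≠ w) (hvw : v ≠ w)
  (ht : {u, v, w} ∈ K.faces) {L : PreAbstractSimplicialComplex V}
  (hL : L.faces = K.faces \ {{u, v}, {u, v, w}})

include huv huw hvw ht hL

lemma edges_mem_of_remove_triangle : {u, w} ∈ L.faces ∧ {v, w} ∈ L.faces := by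
  rw [hL]
  refine ⟨⟨pair_mem ht (by simp) (by simp), ?_⟩, ⟨pair_mem ht (by simp) (by simp), ?_⟩⟩
  · rintro (h | h)
    · have : w ∈ ({u, v} : Finset V) := h ▸ by simp
      simp at this; tauto
    · have : v ∈ ({u, w} : Finset V) := Set.mem_singleton_iff.1 h ▸ by simp
      simp at this; tauto
  · rintro (h | h)
    · have : w ∈ ({u, v} : Finset V) := h ▸ by simp
      simp at this; tauto
    · have : u ∈ ({v, w} : Finset V) := Set.mem_singleton_iff.1 h ▸ by simp
      simp at this; tauto

lemma IsConnected.remove_triangle (hK : K.IsConnected) : L.IsConnected := by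
  intro h hh x y hx hy
  obtain ⟨h1, h2⟩ := edges_mem_of_remove_triangle huv huw hvw ht hL
  refine hK h (fun s hs p hp q hq => ?_) x y (by rw [hL] at hx; exact hx.1)
    (by rw [hL] at hy; exact hy.1)
  rcases mem_or_subset_of_remove_triangle hL hs with h3 | h3
  · exact hh s h3 p hp q hq
  · have key : ∀ p ∈ s, (h p ↔ h w) := by
      intro p hp
      have := h3 hp
      simp only [mem_insert, mem_singleton] at this
      rcases this with rfl | rfl | rfl
      · exact hh _ h1 _ (by simp) _ (by simp)
      · exact hh _ h2 _ (by simp) _ (by simp)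
      · rfl
    rw [key p hp, key q hq]

/-- A cocycle on `L` extends to `K` by assigning to the removed edge uv the value along the detour
through w. -/
lemma CocyclesTrivial.remove_triangle (hK : K.CocyclesTrivial)
    (hfree : ∀ s ∈ L.faces, ¬ {u, v} ⊆ s) : L.CocyclesTrivial := by
  intro c hc
  obtain ⟨h1, h2⟩ := edges_mem_of_remove_triangle huv huw hvw ht hL
  let c' : V → V → ℤ := fun p q =>
    if p = u ∧ q = v then c u w + c w v else if p = v ∧ q = u then c v w + c w u else c p q
  have hcL : ∀ s ∈ L.faces, ∀ p ∈ s, ∀ q ∈ s, c' p q = c p q := by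
    intro s hs p hp q hq
    have h : ¬ (u ∈ s ∧ v ∈ s) := fun h => hfree s hs (by
      intro x; simp only [mem_insert, mem_singleton]; rintro (rfl | rfl); exacts [h.1, h.2])
    simp only [c']
    rw [if_neg, if_neg]
    · rintro ⟨rfl, rfl⟩; exact h ⟨hq, hp⟩
    · rintro ⟨rfl, rfl⟩; exact h ⟨hp, hq⟩
  obtain ⟨g, hg⟩ := hK c' (by
    intro s hs p hp q hq r hr
    rcases mem_or_subset_of_remove_triangle hL hs with h3 | h3
    · rw [hcL s h3 p hp q hq, hcL s h3 q hq r hr, hcL s h3 p hp r hr]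
      exact hc s h3 p hp q hq r hr
    · have euu := hc _ h1 u (by simp) u (by simp) u (by simp)
      have evv := hc _ h2 v (by simp) v (by simp) v (by simp)
      have eww := hc _ h1 w (by simp) w (by simp) w (by simp)
      have euw := hc _ h1 u (by simp) w (by simp) u (by simp)
      have evw := hc _ h2 v (by simp) w (by simp) v (by simp)
      have huu : c' u u = c u u := by simp only [c']; grind
      have hvv : c' v v = c v v := by simp only [c']; grind
      have hww : c' w w = c w w := by simp only [c']; grind
      have huv' : c' u v = c u w + c w v := by simp [c']
      have hvu' : c' v u = c v w + c w u := by simp only [c']; grind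
      have huw' : c' u w = c u w := by simp only [c']; grind
      have hwu' : c' w u = c w u := by simp only [c']; grind
      have hvw' : c' v w = c v w := by simp only [c']; grind
      have hwv' : c' w v = c w v := by simp only [c']; grind
      have hp' := h3 hp
      have hq' := h3 hq
      have hr' := h3 hr
      clear_value c'
      simp only [mem_insert, mem_singleton] at hp' hq' hr'
      rcases hp' with rfl | rfl | rfl <;> rcases hq' with rfl | rfl | rfl <;>
        rcases hr' with rfl | rfl | rfl <;> omega)
  refine ⟨g, fun s hs p hp q hq => ?_⟩
  rw [← hcL s hs p hp q hq]
  exact hg s (by rw [hL] at hs; exact hs.1) p hp q hq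

end removeTriangle

section removeLeaf

variable {K : PreAbstractSimplicialComplex V} {v w : V} (hvw : v ≠ w)
  (he : {v, w} ∈ K.faces) {L : PreAbstractSimplicialComplex V}
  (hL : L.faces = K.faces \ {{v}, {v, w}}) (hfree : ∀ s ∈ L.faces, v ∉ s)

include hvw he hL hfree

/-- Folding the leaf v onto w is a simplicial retraction of `K` onto `L`; functions and cocycles on
`L` are pulled back along it. -/
lemma image_mem_of_remove_leaf {s : Finset V} (hs : s ∈ K.faces) :
    s.image (Function.update id v w) ∈ L.faces := by
  by_cases h : s ∈ ({{v}, {v, w}} : Set (Finset V))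
  · have : s.image (Function.update id v w) = {w} := by
      rcases h with rfl | h
      · simp
      · rw [show s = _ from h]; simp [image_insert, Function.update_of_ne hvw.symm]
    rw [this, hL]
    refine ⟨singleton_mem he (by simp), ?_⟩
    rintro (h | h)
    · exact hvw (singleton_injective h).symm
    · have : v ∈ ({w} : Finset V) := Set.mem_singleton_iff.1 h ▸ by simp
      exact hvw (mem_singleton.1 this)
  · have hsL : s ∈ L.faces := by rw [hL]; exact ⟨hs, h⟩
    have : s.image (Function.update id v w) = s := by
      conv_rhs => rw [← image_id (s := s)]
      refine image_congr fun x hx => ?_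
      exact Function.update_of_ne (fun h : x = v => hfree s hsL (h ▸ mem_coe.1 hx)) _ _
    rwa [this]

lemma IsConnected.remove_leaf (hK : K.IsConnected) : L.IsConnected := by
  intro h hh x y hx hy
  have h1 := hK (fun z => h (Function.update id v w z)) (fun s hs p hp q hq =>
    hh _ (image_mem_of_remove_leaf hvw he hL hfree hs) _ (mem_image_of_mem _ hp) _
      (mem_image_of_mem _ hq)) x y (by rw [hL] at hx; exact hx.1) (by rw [hL] at hy; exact hy.1)
  have e1 : x ≠ v := fun e => hfree _ hx (by simp [e])
  have e2 : y ≠ v := fun e => hfree _ hy (by simp [e])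
  simpa [Function.update_of_ne e1, Function.update_of_ne e2] using h1

lemma CocyclesTrivial.remove_leaf (hK : K.CocyclesTrivial) : L.CocyclesTrivial := by
  intro c hc
  let ρ := Function.update id v w
  obtain ⟨g, hg⟩ := hK (fun p q => c (ρ p) (ρ q)) (fun s hs p hp q hq r hr =>
    hc _ (image_mem_of_remove_leaf hvw he hL hfree hs) _ (mem_image_of_mem _ hp) _
      (mem_image_of_mem _ hq) _ (mem_image_of_mem _ hr))
  refine ⟨g, fun s hs p hp q hq => ?_⟩
  have h := hg s (by rw [hL] at hs; exact hs.1) p hp q hq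
  have e1 : p ≠ v := fun e => hfree _ hs (e ▸ hp)
  have e2 : q ≠ v := fun e => hfree _ hs (e ▸ hq)
  simpa [ρ, Function.update_of_ne e1, Function.update_of_ne e2] using h

end removeLeaf

/-- A connected complex of dimension at most two without nontrivial integral `1`-cocycles is
collapsible, unless it contains a family of triangles without free edges. -/
theorem isCollapsible_of_no_core [Finite V] (K : PreAbstractSimplicialComplex V)
    (hne : K.faces.Nonempty) (hdim : ∀ s ∈ K.faces, #s ≤ 3) (hconn : K.IsConnected)
    (hcoc : K.CocyclesTrivial)
    (hcore : ∀ T : Finset (Finset V), (∀ t ∈ T, t ∈ K.faces ∧ #t = 3) →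
      TriangleFamily.NoFreeEdge T → T = ∅) : K.IsCollapsible := by
  classical
  induction hn : K.faces.ncard using Nat.strong_induction_on generalizing K with
  | _ n ih =>
  subst hn
  by_cases h3 : ∃ t ∈ K.faces, #t = 3
  · let T : Finset (Finset V) := (Set.toFinite {t | t ∈ K.faces ∧ #t = 3}).toFinset
    have hT : ∀ t, t ∈ T ↔ t ∈ K.faces ∧ #t = 3 := fun t => by simp [T]
    have hfree : ¬ TriangleFamily.NoFreeEdge T := by
      intro h
      obtain ⟨t, ht⟩ := h3
      have := hcore T (fun t ht => (hT t).1 ht) h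
      exact absurd ((hT t).2 ht) (by simp [this])
    simp only [TriangleFamily.NoFreeEdge, not_forall] at hfree
    obtain ⟨t, htT, e, het, he2, hdeg⟩ := hfree
    obtain ⟨ht, ht3⟩ := (hT t).1 htT
    obtain ⟨u, v, huv, rfl⟩ := card_eq_two.1 he2
    obtain ⟨w, hw⟩ := card_eq_one.1 (show #(t \ {u, v}) = 1 by
      rw [card_sdiff_of_subset het, ht3, he2])
    have hwt : w ∈ t \ {u, v} := hw ▸ mem_singleton_self w
    simp only [mem_sdiff, mem_insert, mem_singleton, not_or] at hwt
    obtain ⟨-, hwu, hwv⟩ := hwt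
    have ht' : t = {u, v, w} := by
      rw [← sdiff_union_of_subset het, hw]; ext x; simp; tauto
    subst ht'
    have he : {u, v} ∈ K.faces := mem_of_subset ht het ⟨u, by simp⟩
    have hmax : ∀ s ∈ K.faces, {u, v} ⊆ s → s = {u, v} ∨ s = {u, v, w} := by
      intro s hs hus
      have h2 := card_le_card hus
      have h4 := hdim s hs
      rw [he2] at h2
      rcases (show #s = 2 ∨ #s = 3 by omega) with h | h
      · left; exact (eq_of_subset_of_card_le hus (by rw [he2, h])).symm
      · right
        by_contra hsne
        apply hdeg
        -- A second triangle on uv would give the edge degree at least 2.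
        have : 1 < #{t ∈ T | {u, v} ⊆ t} :=
          one_lt_card.2 ⟨s, mem_filter.2 ⟨(hT s).2 ⟨hs, h⟩, hus⟩, _, mem_filter.2 ⟨htT, het⟩, hsne⟩
        exact this
    refine IsCollapsible.of_removeFree he ht het (by rw [ht3, he2]) hmax ?_
    have hL : (K.removeFree {u, v} {u, v, w} het hmax).faces = K.faces \ {{u, v}, {u, v, w}} := rfl
    refine ih _ (ncard_removeFree_lt he het hmax) _ ?_ (fun s hs => hdim s hs.1) ?_ ?_
      (fun T hT => hcore T fun t ht => ⟨(hT t ht).1.1, (hT t ht).2⟩) rfl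
    · exact ⟨_, (edges_mem_of_remove_triangle huv (Ne.symm hwu) (Ne.symm hwv) ht hL).1⟩
    · exact hconn.remove_triangle huv (Ne.symm hwu) (Ne.symm hwv) ht hL
    · refine hcoc.remove_triangle huv (Ne.symm hwu) (Ne.symm hwv) ht hL fun s hs hsub => ?_
      exact hs.2 (hmax s hs.1 hsub)
  · have hdim2 : ∀ s ∈ K.faces, #s ≤ 2 := by
      intro s hs
      have h1 := hdim s hs
      have h2 : #s ≠ 3 := fun h => h3 ⟨s, hs, h⟩
      omega
    by_cases h2 : ∃ e ∈ K.faces, #e = 2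
    · obtain ⟨e, he, he2⟩ := h2
      obtain ⟨v, w, hvw, hvwK, huniq⟩ := exists_leaf hconn hcoc hdim2 he he2
      have hv : {v} ∈ K.faces := singleton_mem hvwK (by simp)
      have hsub : ({v} : Finset V) ⊆ {v, w} := by simp
      have hmax : ∀ s ∈ K.faces, {v} ⊆ s → s = {v} ∨ s = {v, w} := by
        intro s hs hvs
        have h1 := card_le_card hvs
        have h4 := hdim2 s hs
        rw [card_singleton] at h1
        rcases (show #s = 1 ∨ #s = 2 by omega) with h | h
        · left; exact (eq_of_subset_of_card_le hvs (by rw [card_singleton, h])).symm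
        · right
          obtain ⟨x, hx⟩ := card_eq_one.1 (show #(s.erase v) = 1 by
            rw [card_erase_of_mem (singleton_subset_iff.1 hvs), h])
          have hs' : s = {v, x} := by
            rw [← insert_erase (singleton_subset_iff.1 hvs), hx]
          have hxv : v ≠ x := by
            rintro rfl
            exact notMem_erase v s (hx ▸ mem_singleton_self v)
          rw [hs', huniq x hxv (hs' ▸ hs)]
      refine IsCollapsible.of_removeFree hv hvwK hsub (by rw [card_pair hvw, card_singleton]) hmax ?_
      have hL : (K.removeFree {v} {v, w} hsub hmax).faces = K.faces \ {{v}, {v, w}} := rfl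
      have hfree : ∀ s ∈ (K.removeFree {v} {v, w} hsub hmax).faces, v ∉ s := fun s hs hvs =>
        hs.2 (hmax s hs.1 (singleton_subset_iff.2 hvs))
      refine ih _ (ncard_removeFree_lt hv hsub hmax) _ ?_ (fun s hs => hdim s hs.1) ?_ ?_
        (fun T hT => hcore T fun t ht => ⟨(hT t ht).1.1, (hT t ht).2⟩) rfl
      · exact ⟨_, image_mem_of_remove_leaf hvw hvwK hL hfree hv⟩
      · exact hconn.remove_leaf hvw hvwK hL hfree
      · exact hcoc.remove_leaf hvw hvwK hL hfree
    · have h1 : ∀ s ∈ K.faces, ∃ x, s = {x} := by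
        intro s hs
        have h4 := hdim2 s hs
        have h5 : #s ≠ 2 := fun h => h2 ⟨s, hs, h⟩
        have h6 := card_pos.2 (K.isRelLowerSet_faces hs).1
        exact card_eq_one.1 (by omega)
      obtain ⟨s, hs⟩ := hne
      obtain ⟨v, rfl⟩ := h1 s hs
      refine ⟨K, v, Relation.ReflTransGen.refl, ?_⟩
      ext t
      refine ⟨fun ht => ?_, fun ht => by rwa [show t = {v} from ht]⟩
      obtain ⟨x, rfl⟩ := h1 t ht
      -- When all faces are vertices, every function is constant on faces; the indicator of v shows
      -- that v is the only vertex.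
      have := hconn (fun y => y = v) (fun s hs p hp q hq => by
        obtain ⟨y, rfl⟩ := h1 s hs
        rw [mem_singleton.1 hp, mem_singleton.1 hq]) v x hs ht
      rw [this.1 rfl]; rfl

end PreAbstractSimplicialComplex

end Collapsing

theorem lemma4p2 {V : Type*} [Finite V] (C : PreAbstractSimplicialComplex V)
    (hdim : C.IsTwoDimensional) (hcontr : C.IsContractible) (hncoll : ¬ C.IsCollapsible) :
    8 ≤ C.vertexSet.ncard ∧ 17 ≤ C.triangles.ncard := by
  classical
  have := Fintype.ofFinite V
  have : ContractibleSpace C.realization := hcontr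
  obtain ⟨T, hT, hcore, hne⟩ : ∃ T : Finset (Finset V), (∀ t ∈ T, t ∈ C.faces ∧ t.card = 3) ∧
      TriangleFamily.NoFreeEdge T ∧ T ≠ ∅ := by
    by_contra! h
    obtain ⟨t, ht, -⟩ := hdim.2
    refine hncoll (C.isCollapsible_of_no_core ⟨t, ht⟩ hdim.1 ?_ ?_ h)
    · exact fun h hh v w hv hw => iff_of_eq (C.vertices_eq_of_preconnected h
        (fun s hs p hp q hq => propext (hh s hs p hp q hq)) hv hw)
    · exact fun c hc => C.exists_eq_sub_of_cocycle hc
  obtain ⟨h8, h17⟩ := TriangleFamily.bounds (fun t ht => (hT t ht).2)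
    (Finset.nonempty_iff_ne_empty.2 hne) hcore fun S hS hcyc =>
      C.eq_empty_of_isCycle hdim.1 (fun t ht => (hT t (hS ht)).1) (fun t ht => (hT t (hS ht)).2) hcyc
  constructor
  · refine h8.trans ?_
    rw [← Set.ncard_coe_finset]
    refine Set.ncard_le_ncard (fun v hv => ?_) (Set.toFinite _)
    obtain ⟨t, ht, hvt⟩ := TriangleFamily.mem_verts.1 hv
    exact PreAbstractSimplicialComplex.singleton_mem (hT t ht).1 hvt
  · refine h17.trans ?_
    rw [← Set.ncard_coe_finset]
    exact Set.ncard_le_ncard (fun t ht => hT t ht) (Set.toFinite _)
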